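/- Let $K$ be an algebraically closed field, and let $R=K\langle t_1,\dots,t_m\rangle/\langle r_1,\dots,r_s\rangle$ be a connected graded algebra, where the generators $t_k$ have degree $1$ and $r_1,\dots,r_s$ is a minimal system of homogeneous relations of degrees $d_i\ge 2$. Assume that $R$ is Artin--Schelter regular of dimension $2$: the trivial module $K=R/R_+$ has projective dimension $2$, $R$ has finite Gelfand--Kirillov dimension, and $\mathrm{Ext}^i_R(K,R)=0$ for $i\ne 2$, $\mathrm{Ext}^2_R(K,R)\cong K$. Let $U=K\langle t_1,\dots,t_m\rangle/\langle r_1+l_1,\dots,r_s+l_s\rangle$ with $\deg l_i<d_i$ be a PBW deformation of $R$, i.e. the associated graded algebra of $U$ for the filtration induced by word length is isomorphic to $R$ as a graded algebra. Then $U$ is a $\sigma$-filtered skew PBW extension, in at least one variable, of a positively filtered subalgebra $B$, where either $B=K$ with the trivial filtration ($\mathcal F_p(K)=K$ for all $p\ge 0$), or $B\cong K[y]$ is a polynomial algebra filtered by degree in $y$. That is, there are $n\ge 1$ and $x_1,\dots,x_n\in U$ such that: * $U$ is a free left $B$-module with basis the monomials $x^\alpha=x_1^{\alpha_1}\cdots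 x_n^{\alpha_n}$, $\alpha\in\mathbb N^n$; for every $i$ and $0\ne b\in B$ there is $0\ne c\in B$ with $x_ib-cx_i\in B$; and for all $i,j$ there is $0\ne d\in B$ with $x_jx_i-d\,x_ix_j\in B+Bx_1+\cdots+Bx_n$; * the (unique) injective endomorphisms $\sigma_i$ of $B$ and $\sigma_i$-derivations $\delta_i$ with $x_ib=\sigma_i(b)x_i+\delta_i(b)$ satisfy $\sigma_i(\mathcal F_p(B))\subseteq \mathcal F_p(B)$ and $\delta_i(\mathcal F_p(B))\subseteq\mathcal F_{p+1}(B)$ for all $p$; * $\mathrm{tdeg}(x_jx_i)=2$ for all $i,j$, where $\mathrm{tdeg}\bigl(\sum_\alpha c_\alpha x^\alpha\bigr)=\max\{\deg c_\alpha+|\alpha| : c_\alpha\neq 0\}$ and $\deg c=\min\{p: c\in\mathcal F_p(B)\}$. -/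

import Mathlib

universe u v

namespace SkewPBW

noncomputable section

/-! ### Filtered algebras and associated graded algebras -/

/-- A positive filtration on a `K`-algebra `A`: an increasing, exhaustive, multiplicative family
of subspaces indexed by `ℕ` (the pieces of negative index are understood to be zero). -/
structure PosFiltration (K : Type u) (A : Type v) [Field K] [Ring A] [Algebra K A] where
  piece : ℕ → Submodule K A
  mono : ∀ p, piece p ≤ piece (p + 1)
  one_mem : (1 : A) ∈ piece 0
  mul_mem : ∀ {p q : ℕ} {a b : A}, a ∈ piece p → b ∈ piece q → a * b ∈ piece (p + q)
  exhaust : ∀ a : A, ∃ p, a ∈ piece p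

namespace PosFiltration

variable {K : Type u} {A : Type v} [Field K] [Ring A] [Algebra K A] (F : PosFiltration K A)

/-- The degree `min {p | a ∈ F_p}` of an element of a positively filtered algebra
(only meaningful for `a ≠ 0`). -/
def deg (a : A) : ℕ := sInf {p | a ∈ F.piece p}

/-- The subspace `F_{p-1}`. -/
def lower : ℕ → Submodule K A
  | 0 => ⊥
  | p + 1 => F.piece p

theorem lower_mul {i j : ℕ} {a b : A} (ha : a ∈ F.lower i) (hb : b ∈ F.piece j) :
    a * b ∈ F.lower (i + j) := by
  cases i with
  | zero =>
    have h0 : a = 0 := by simpa [lower] using ha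
    simp [h0]
  | succ i =>
    rw [show i + 1 + j = (i + j) + 1 by omega]
    exact F.mul_mem ha hb

theorem mul_lower {i j : ℕ} {a b : A} (ha : a ∈ F.piece i) (hb : b ∈ F.lower j) :
    a * b ∈ F.lower (i + j) := by
  cases j with
  | zero =>
    have h0 : b = 0 := by simpa [lower] using hb
    simp [h0]
  | succ j => exact F.mul_mem ha hb

/-- The graded piece `F_p / F_{p-1}`. -/
def gr (p : ℕ) : Type v := F.piece p ⧸ (F.lower p).comap (F.piece p).subtype

instance grAddCommGroup (p : ℕ) : AddCommGroup (F.gr p) :=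
  inferInstanceAs (AddCommGroup (F.piece p ⧸ (F.lower p).comap (F.piece p).subtype))

instance grModule (p : ℕ) : Module K (F.gr p) :=
  inferInstanceAs (Module K (F.piece p ⧸ (F.lower p).comap (F.piece p).subtype))

/-- The class in `F_p / F_{p-1}` of an element of `F_p`. -/
def grMk {p : ℕ} (a : A) (ha : a ∈ F.piece p) : F.gr p := Submodule.Quotient.mk ⟨a, ha⟩

theorem grMk_surj {p : ℕ} (x : F.gr p) : ∃ a ha, x = F.grMk a ha := by
  obtain ⟨⟨a, ha⟩, rfl⟩ := Submodule.Quotient.mk_surjective _ x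
  exact ⟨a, ha, rfl⟩

theorem mk_grMk_congr {p q : ℕ} (h : p = q) {a b : A} (hab : a = b) (ha : a ∈ F.piece p)
    (hb : b ∈ F.piece q) :
    GradedMonoid.mk (A := F.gr) p (F.grMk a ha) = GradedMonoid.mk q (F.grMk b hb) := by
  subst h hab; rfl

/-- Multiplication before passing to the quotients. -/
def grMulAux (i j : ℕ) : F.piece i →ₗ[K] F.piece j →ₗ[K] F.gr (i + j) :=
  LinearMap.mk₂ K (fun a b => F.grMk (a.1 * b.1) (F.mul_mem a.2 b.2))
    (fun _ _ _ => congrArg Submodule.Quotient.mk (Subtype.ext (add_mul _ _ _)))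
    (fun _ _ _ => congrArg Submodule.Quotient.mk (Subtype.ext (smul_mul_assoc _ _ _)))
    (fun _ _ _ => congrArg Submodule.Quotient.mk (Subtype.ext (mul_add _ _ _)))
    (fun _ _ _ => congrArg Submodule.Quotient.mk (Subtype.ext (mul_smul_comm _ _ _)))

/-- The multiplication `F_i / F_{i-1} × F_j / F_{j-1} → F_{i+j} / F_{i+j-1}`. -/
def grMul (i j : ℕ) : F.gr i →ₗ[K] F.gr j →ₗ[K] F.gr (i + j) :=
  Submodule.liftQ _
    (Submodule.liftQ ((F.lower j).comap (F.piece j).subtype) (F.grMulAux i j).flip (by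
      intro b hb
      ext a
      exact (Submodule.Quotient.mk_eq_zero _).2 (F.mul_lower a.2 hb))).flip (by
    intro a ha
    apply Submodule.linearMap_qext
    ext b
    exact (Submodule.Quotient.mk_eq_zero _).2 (F.lower_mul ha b.2))

@[simp] theorem grMul_grMk {i j : ℕ} {a b : A} (ha : a ∈ F.piece i) (hb : b ∈ F.piece j) :
    F.grMul i j (F.grMk a ha) (F.grMk b hb) = F.grMk (a * b) (F.mul_mem ha hb) := rfl

instance grGOne : GradedMonoid.GOne F.gr where
  one := F.grMk 1 F.one_mem

instance grGMul : GradedMonoid.GMul F.gr where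
  mul {i j} x y := F.grMul i j x y

instance grGSemiring : DirectSum.GSemiring F.gr where
  __ := F.grGOne
  __ := F.grGMul
  mul_zero {i j} x := map_zero (F.grMul i j x)
  zero_mul {i j} x := LinearMap.map_zero₂ (F.grMul i j) x
  mul_add {i j} x y z := map_add (F.grMul i j x) y z
  add_mul {i j} x y z := LinearMap.map_add₂ (F.grMul i j) x y z
  one_mul := by
    rintro ⟨i, x⟩
    obtain ⟨a, ha, rfl⟩ := F.grMk_surj x
    exact F.mk_grMk_congr (zero_add i) (one_mul a) _ _
  mul_one := by
    rintro ⟨i, x⟩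
    obtain ⟨a, ha, rfl⟩ := F.grMk_surj x
    exact F.mk_grMk_congr (add_zero i) (mul_one a) _ _
  mul_assoc := by
    rintro ⟨i, x⟩ ⟨j, y⟩ ⟨k, z⟩
    obtain ⟨a, ha, rfl⟩ := F.grMk_surj x
    obtain ⟨b, hb, rfl⟩ := F.grMk_surj y
    obtain ⟨c, hc, rfl⟩ := F.grMk_surj z
    exact F.mk_grMk_congr (add_assoc i j k) (mul_assoc a b c) _ _
  natCast n := n • F.grMk 1 F.one_mem
  natCast_zero := zero_nsmul _
  natCast_succ n := succ_nsmul _ n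

instance grGAlgebra : DirectSum.GAlgebra K F.gr where
  toFun :=
    { toFun := fun c => c • F.grMk 1 F.one_mem
      map_zero' := zero_smul _ _
      map_add' := fun c d => add_smul c d _ }
  map_one := one_smul _ _
  map_mul c d := by
    refine F.mk_grMk_congr (a := (c * d) • (1 : A)) (b := (c • (1 : A)) * (d • (1 : A)))
      (zero_add 0).symm ?_ (Submodule.smul_mem _ _ F.one_mem) ?_
    · rw [smul_mul_smul_comm, one_mul]
  commutes := by
    rintro c ⟨i, x⟩
    obtain ⟨a, ha, rfl⟩ := F.grMk_surj x
    refine F.mk_grMk_congr (a := (c • (1 : A)) * a) (b := a * (c • (1 : A)))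
      ((zero_add i).trans (add_zero i).symm) (by simp) ?_ ?_
  smul_def := by
    rintro c ⟨i, x⟩
    obtain ⟨a, ha, rfl⟩ := F.grMk_surj x
    refine F.mk_grMk_congr (a := c • a) (b := (c • (1 : A)) * a)
      (zero_add i).symm (by simp) (Submodule.smul_mem _ _ ha) ?_

/-- The associated graded algebra `G(A) = ⨁ F_p / F_{p-1}`. -/
abbrev AssocGraded : Type v := DirectSum ℕ F.gr

end PosFiltration

/-! ### Presented algebras, standard filtrations and deformations -/

section Words

variable {K : Type u} {A : Type v} [Field K] [Ring A] [Algebra K A] {m : ℕ}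

/-- The span of the words of length exactly `p` in the elements `t₁, …, tₘ`. -/
def wordSpan (K : Type u) {A : Type v} [Field K] [Ring A] [Algebra K A] {m : ℕ}
    (t : Fin m → A) (p : ℕ) : Submodule K A :=
  Submodule.span K (Set.range t) ^ p

/-- The span of the words of length at most `p` in the elements `t₁, …, tₘ`, that is, of all
products of `p` elements of `{1, t₁, …, tₘ}`. -/
def wordSpanLE (K : Type u) {A : Type v} [Field K] [Ring A] [Algebra K A] {m : ℕ}
    (t : Fin m → A) (p : ℕ) : Submodule K A :=
  Submodule.span K (insert 1 (Set.range t)) ^ p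

/-- The standard filtration of an algebra with respect to a finite family of generators. -/
def standardFiltration (t : Fin m → A) (ht : Algebra.adjoin K (Set.range t) = ⊤) :
    PosFiltration K A where
  piece := wordSpanLE K t
  mono p := by
    have h1 : (1 : Submodule K A) ≤ Submodule.span K (insert 1 (Set.range t)) :=
      Submodule.one_le.2 (Submodule.subset_span (Set.mem_insert _ _))
    exact pow_le_pow_right₀ h1 (Nat.le_succ p)
  one_mem := by rw [wordSpanLE, pow_zero]; exact Submodule.one_le.1 le_rfl
  mul_mem {p q a b} ha hb := by
    unfold wordSpanLE
    rw [pow_add]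
    exact Submodule.mul_mem_mul ha hb
  exhaust a := by
    have h1 : (1 : Submodule K A) ≤ Submodule.span K (insert 1 (Set.range t)) :=
      Submodule.one_le.2 (Submodule.subset_span (Set.mem_insert _ _))
    have ha : a ∈ Algebra.adjoin K (Set.range t) := by rw [ht]; trivial
    induction ha using Algebra.adjoin_induction with
    | mem x hx =>
      exact ⟨1, by
        rw [wordSpanLE, pow_one]; exact Submodule.subset_span (Set.mem_insert_of_mem _ hx)⟩
    | algebraMap c =>
      exact ⟨0, by rw [wordSpanLE, pow_zero]; exact Submodule.algebraMap_mem c⟩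
    | add x y _ _ hx hy =>
      obtain ⟨p, hp⟩ := hx
      obtain ⟨q, hq⟩ := hy
      exact ⟨max p q, Submodule.add_mem _ (pow_le_pow_right₀ h1 (le_max_left p q) hp)
        (pow_le_pow_right₀ h1 (le_max_right p q) hq)⟩
    | mul x y _ _ hx hy =>
      obtain ⟨p, hp⟩ := hx
      obtain ⟨q, hq⟩ := hy
      exact ⟨p + q, by
        unfold wordSpanLE; rw [pow_add]; exact Submodule.mul_mem_mul hp hq⟩

end Words

section Presented

variable {K : Type u} [Field K] {m s : ℕ}

/-- The algebra `K⟨t₁, …, tₘ⟩ / ⟨f₁, …, f_s⟩`. -/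
abbrev Presented (f : Fin s → FreeAlgebra K (Fin m)) : Type u :=
  RingQuot (fun a b : FreeAlgebra K (Fin m) => (∃ i, a = f i) ∧ b = 0)

/-- The generators of a presented algebra. -/
def gen (f : Fin s → FreeAlgebra K (Fin m)) (k : Fin m) : Presented f :=
  RingQuot.mkAlgHom K _ (FreeAlgebra.ι K k)

theorem adjoin_gen (f : Fin s → FreeAlgebra K (Fin m)) :
    Algebra.adjoin K (Set.range (gen f)) = ⊤ := by
  have h : Set.range (gen f) =
      (RingQuot.mkAlgHom K
        (fun a b : FreeAlgebra K (Fin m) => (∃ i, a = f i) ∧ b = 0)) ''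
        Set.range (FreeAlgebra.ι K) := by
    rw [← Set.range_comp]; rfl
  rw [h, ← AlgHom.map_adjoin, FreeAlgebra.adjoin_range_ι, Algebra.map_top]
  exact AlgHom.range_eq_top _ |>.2 (RingQuot.mkAlgHom_surjective K _)

/-- The filtration on `K⟨t₁, …, tₘ⟩ / ⟨f₁, …, f_s⟩` induced by the standard filtration of the
free algebra. -/
def Presented.filtration (f : Fin s → FreeAlgebra K (Fin m)) : PosFiltration K (Presented f) :=
  standardFiltration (gen f) (adjoin_gen f)

/-- `r₁, …, r_s` is a minimal system of homogeneous, non-linear relations, with `r_i` of degree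
`d_i`; all generators have degree one. The presented algebra is then connected graded. -/
structure IsHomogeneousPresentation (r : Fin s → FreeAlgebra K (Fin m)) (d : Fin s → ℕ) :
    Prop where
  two_le : ∀ i, 2 ≤ d i
  homogeneous : ∀ i, r i ∈ wordSpan K (FreeAlgebra.ι K) (d i)
  minimal : ∀ i, r i ∉ TwoSidedIdeal.span (r '' {j | j ≠ i})

/-- `U = K⟨t⟩ / ⟨r₁ + l₁, …, r_s + l_s⟩` is a PBW deformation of the connected graded algebra
`R = K⟨t⟩ / ⟨r₁, …, r_s⟩`: the degree of `l_i` is less than the degree `d_i` of `r_i`, and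
the associated graded algebra of `U` is isomorphic to `R` as a graded algebra. -/
structure IsPBWDeformation (r : Fin s → FreeAlgebra K (Fin m)) (d : Fin s → ℕ)
    (l : Fin s → FreeAlgebra K (Fin m)) : Prop where
  deg_lt : ∀ i, l i ∈ wordSpanLE K (FreeAlgebra.ι K) (d i - 1)
  graded_iso : ∃ e : (Presented.filtration (r + l)).AssocGraded ≃ₐ[K] Presented r,
    ∀ p, Submodule.map e.toLinearMap
      (LinearMap.range (DirectSum.lof K ℕ (Presented.filtration (r + l)).gr p)) =
        wordSpan K (gen r) p

end Presented

/-! ### Artin–Schelter regular algebras -/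

section Regular

variable {K : Type u} [Field K] {m s : ℕ}

open CategoryTheory

/-- The trivial left module `K = R / R₊`, with `R₊` the (left) ideal generated by the generators of
degree one. -/
abbrev trivialModule (r : Fin s → FreeAlgebra K (Fin m)) : ModuleCat.{u} (Presented r) :=
  ModuleCat.of (Presented r) (Presented r ⧸ Ideal.span (Set.range (gen r)))

/-- The Gelfand–Kirillov dimension `limsup log_n (dim Vⁿ)`, with `V` the span of `1` and of the
generators. -/
def gkDim (r : Fin s → FreeAlgebra K (Fin m)) : EReal :=
  Filter.limsup (fun n : ℕ =>
    ((Real.logb n (Module.finrank K (wordSpanLE K (gen r) n)) : ℝ) : EReal)) Filter.atTop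

/-- The connected graded algebra `R = K⟨t⟩ / ⟨r₁, …, r_s⟩` is Artin–Schelter regular of
dimension `n`: it has finite global dimension `n`, finite Gelfand–Kirillov dimension, and
`Ext^i_R(K, R)` vanishes for `i ≠ n` and is isomorphic to `K` for `i = n`. -/
structure IsASRegular (r : Fin s → FreeAlgebra K (Fin m)) (n : ℕ) : Prop where
  gldim : projectiveDimension (trivialModule r) = n
  gkdim : gkDim r < ⊤
  ext_ne : ∀ i, i ≠ n →
    Subsingleton (Abelian.Ext (trivialModule r) (ModuleCat.of (Presented r) (Presented r)) i)
  ext_eq : Nonempty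
    (Abelian.Ext (trivialModule r) (ModuleCat.of (Presented r) (Presented r)) n ≃ₗ[K] K)

end Regular

/-! ### Skew PBW extensions -/

section Skew

variable {K : Type u} {A : Type v} [Field K] [Ring A] [Algebra K A] {n : ℕ}

/-- The standard monomial `x^α = x₁^α₁ ⋯ xₙ^αₙ`. -/
def mon (x : Fin n → A) (α : Fin n → ℕ) : A := (List.ofFn fun i => x i ^ α i).prod

/-- `A` is a skew PBW extension of its subalgebra `R` in the variables `x₁, …, xₙ`. -/
structure IsSkewPBWExtension (R : Subalgebra K A) (x : Fin n → A) : Prop where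
  linearIndependent : LinearIndependent R (mon x)
  span_eq_top : ⊤ ≤ Submodule.span R (Set.range (mon x))
  comm_coeff : ∀ i, ∀ r : R, r ≠ 0 → ∃ c : R, c ≠ 0 ∧ x i * r - c * x i ∈ R
  comm_var : ∀ i j, ∃ d : R, d ≠ 0 ∧
    x j * x i - d * (x i * x j) ∈ Submodule.span R (insert 1 (Set.range x))

/-- The left `R`-basis of standard monomials. -/
def IsSkewPBWExtension.basis {R : Subalgebra K A} {x : Fin n → A}
    (h : IsSkewPBWExtension R x) : Module.Basis (Fin n → ℕ) R A :=
  Module.Basis.mk h.linearIndependent h.span_eq_top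

/-- The total degree of `f = ∑ c_α x^α`: the maximum of `deg c_α + |α|` over the `α` with
`c_α ≠ 0` (only meaningful for `f ≠ 0`). -/
def IsSkewPBWExtension.tdeg {R : Subalgebra K A} {x : Fin n → A}
    (h : IsSkewPBWExtension R x) (F : PosFiltration K R) (f : A) : ℕ :=
  (h.basis.repr f).support.sup fun α => F.deg (h.basis.repr f α) + ∑ i, α i

/-- `A` is a `σ`-filtered skew PBW extension of the positively filtered algebra `(R, F)` in the
variables `x₁, …, xₙ`. The maps `σ_i` and `δ_i` are uniquely determined by
`x_i r = σ_i(r) x_i + δ_i(r)`. -/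
structure IsSigmaFiltered (R : Subalgebra K A) (F : PosFiltration K R) (x : Fin n → A) :
    Prop where
  skewPBW : IsSkewPBWExtension R x
  filtered : ∃ (σ : Fin n → R →ₐ[K] R) (δ : Fin n → R →ₗ[K] R),
    (∀ i, Function.Injective (σ i)) ∧
    (∀ i a b, δ i (a * b) = σ i a * δ i b + δ i a * b) ∧
    (∀ i (a : R), x i * a = σ i a * x i + δ i a) ∧
    (∀ i p, ∀ a ∈ F.piece p, σ i a ∈ F.piece p) ∧
    (∀ i p, ∀ a ∈ F.piece p, δ i a ∈ F.piece (p + 1))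
  preserves_tdeg : ∀ i j, skewPBW.tdeg F (x j * x i) = 2

/-- `R` is the base field `K` with its trivial connected filtration. -/
def IsTrivialBase (R : Subalgebra K A) (F : PosFiltration K R) : Prop :=
  R = ⊥ ∧ ∀ p, F.piece p = ⊤

/-- `R` is a polynomial algebra `K[y]` filtered by the degree in `y`. -/
def IsPolynomialBase (R : Subalgebra K A) (F : PosFiltration K R) : Prop :=
  ∃ e : Polynomial K ≃ₐ[K] R,
    ∀ p : ℕ, F.piece p = (Polynomial.degreeLE K (p : WithBot ℕ)).map e.toLinearMap

end Skew

end

end SkewPBW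

namespace SkewPBW

open Polynomial

/-! ### The grading by word length as a coaction `S → S[X]` -/

section Coaction

variable {K : Type u} {S : Type v} [Field K] [Ring S] [Algebra K S] {m : ℕ} {t : Fin m → S}

/-! Homological part. Write each relation as r_i = ∑ q_ij t_j. The matrix of the classes of the q_ij
gives the start R^s → R^m → R of the minimal free resolution of the trivial module. Since the
projective dimension is two, the module of syzygies of the generators is projective; by minimality
of the relations the surjection from R^s onto it is then an isomorphism (`relationMap_injective`),
through a graded version of Nakayama's lemma. Hence Ext² is the cokernel of the transpose R^m → R^s
(`exists_addMonoidHom_of_ext_two`). The q_ij have positive degree, so this cokernel still maps onto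
K^s; as it is K, there is exactly one relation, and every generator lies in the right ideal spanned
by the q_1j. In degree one this says that the relation is quadratic with an invertible coefficient
matrix (`exists_nondegenerate_matrix`).

Growth. The resolution gives dim R_{n+2} ≥ m dim R_{n+1} - dim R_n, which is exponential growth for
m ≥ 3 and contradicts finite Gelfand–Kirillov dimension. For m = 1 the relation is a multiple of t²,
and t is a nontrivial syzygy. So m = 2 (`card_generators_eq_two`).

Explicit part. Now U has two generators and one relation, a nondegenerate quadratic form plus terms
of degree at most one. Over an algebraically closed field the form has an isotropic vector, so in
suitable linear coordinates x, y there is no x² term, and nondegeneracy makes the coefficients of xy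
and yx both nonzero. Solving for xy gives xy = σ(y)x + δ(y) with σ(y) of degree one and δ(y) of
degree at most two in y: U is the Ore extension K[y][x; σ, δ]. The monomials in x span because of
this rule; they are independent over K[y] because U acts on the explicitly constructed Ore extension
(`exists_isSigmaFiltered_of_ore`). Thus one variable over K[y] always suffices. -/

theorem generator_mem_wordSpan_one (i : Fin m) : t i ∈ wordSpan K t 1 := by
  rw [wordSpan, pow_one]
  exact Submodule.subset_span ⟨i, rfl⟩

theorem mul_mem_wordSpan {p q : ℕ} {a b : S} (ha : a ∈ wordSpan K t p)
    (hb : b ∈ wordSpan K t q) : a * b ∈ wordSpan K t (p + q) := by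
  unfold wordSpan at *
  rw [pow_add]
  exact Submodule.mul_mem_mul ha hb

theorem exists_eq_sum_mul_of_mem_wordSpan_succ {p : ℕ} {a : S}
    (ha : a ∈ wordSpan K t (p + 1)) :
    ∃ g : Fin m → S, (∀ j, g j ∈ wordSpan K t p) ∧ a = ∑ j, g j * t j := by
  unfold wordSpan at ha
  rw [pow_succ] at ha
  induction ha using Submodule.mul_induction_on' with
  | mem_mul_mem b hb c hc =>
    obtain ⟨f, rfl⟩ := (Submodule.mem_span_range_iff_exists_fun K).1 hc
    refine ⟨fun j => f j • b, fun j => Submodule.smul_mem _ _ hb, ?_⟩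
    simp [Finset.mul_sum]
  | add x _ y _ hx hy =>
    obtain ⟨g, hg, rfl⟩ := hx
    obtain ⟨h, hh, rfl⟩ := hy
    exact ⟨fun j => g j + h j, fun j => add_mem (hg j) (hh j), by
      simp [add_mul, Finset.sum_add_distrib]⟩

/-- Every element is a scalar plus a left combination of the generators. -/
theorem exists_eq_augmentation_add_sum (ht : Algebra.adjoin K (Set.range t) = ⊤)
    (ε : S →ₐ[K] K) (hε : ∀ i, ε (t i) = 0) (a : S) :
    ∃ g : Fin m → S, a = algebraMap K S (ε a) + ∑ j, g j * t j := by
  have ha : a ∈ Algebra.adjoin K (Set.range t) := by rw [ht]; trivial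
  induction ha using Algebra.adjoin_induction with
  | mem x hx =>
    obtain ⟨i, rfl⟩ := hx
    refine ⟨Pi.single i 1, ?_⟩
    simp [hε, Pi.single_apply]
  | algebraMap c => exact ⟨0, by simp⟩
  | add x y _ _ hx hy =>
    obtain ⟨g, hg⟩ := hx
    obtain ⟨h, hh⟩ := hy
    refine ⟨fun j => g j + h j, ?_⟩
    conv_lhs => rw [hg, hh]
    simp only [map_add, add_mul, Finset.sum_add_distrib]
    abel
  | mul x y _ _ hx hy =>
    obtain ⟨g, hg⟩ := hx
    obtain ⟨h, hh⟩ := hy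
    -- Expand only the right factor: x y = x ε(y) + ∑ x h_j t_j, and then expand x in the first
    -- term.
    refine ⟨fun j => ε y • g j + x * h j, ?_⟩
    conv_lhs => rw [hh, mul_add]
    have h1 : x * algebraMap K S (ε y) =
        algebraMap K S (ε x * ε y) + ∑ j, (ε y • g j) * t j := by
      conv_lhs => rw [hg]
      rw [add_mul, map_mul, Finset.sum_mul]
      congr 1
      refine Finset.sum_congr rfl fun j _ => ?_
      rw [← Algebra.commutes, ← Algebra.smul_def, smul_mul_assoc]
    rw [h1, ← map_mul ε]
    simp only [add_mul, Finset.sum_add_distrib, Finset.mul_sum, mul_assoc, add_assoc]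

variable {ρ : S →ₐ[K] S[X]}

/-- Since the variable is central in `S[X]`, a map sending each generator t to tX multiplies a word
of length p by X^p. The components of an element are thus the coefficients of its image, and no
direct sum decomposition is needed. -/
theorem coaction_of_mem_wordSpan (hρ : ∀ i, ρ (t i) = monomial 1 (t i)) {p : ℕ} {a : S}
    (ha : a ∈ wordSpan K t p) : ρ a = monomial p a := by
  induction p generalizing a with
  | zero =>
    rw [wordSpan, pow_zero] at ha
    obtain ⟨c, rfl⟩ := Submodule.mem_one.1 ha
    rw [AlgHom.commutes]
    rfl
  | succ p ih =>
    obtain ⟨g, hg, rfl⟩ := exists_eq_sum_mul_of_mem_wordSpan_succ ha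
    simp only [map_sum, map_mul, hρ, ih (hg _), monomial_mul_monomial]

theorem coeff_coaction_mem_wordSpan (ht : Algebra.adjoin K (Set.range t) = ⊤)
    (hρ : ∀ i, ρ (t i) = monomial 1 (t i)) (a : S) (n : ℕ) :
    (ρ a).coeff n ∈ wordSpan K t n := by
  have ha : a ∈ Algebra.adjoin K (Set.range t) := by rw [ht]; trivial
  induction ha using Algebra.adjoin_induction generalizing n with
  | mem x hx =>
    obtain ⟨i, rfl⟩ := hx
    rw [hρ, coeff_monomial]
    split_ifs with h
    · subst h; exact generator_mem_wordSpan_one i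
    · exact zero_mem _
  | algebraMap c =>
    rw [AlgHom.commutes, Polynomial.algebraMap_apply, coeff_C]
    split_ifs with h
    · subst h
      rw [wordSpan, pow_zero]
      exact Submodule.algebraMap_mem c
    · exact zero_mem _
  | add x y _ _ hx hy => rw [map_add, coeff_add]; exact add_mem (hx n) (hy n)
  | mul x y _ _ hx hy =>
    rw [map_mul, coeff_mul]
    refine sum_mem fun p hp => ?_
    rw [← Finset.HasAntidiagonal.mem_antidiagonal.1 hp]
    exact mul_mem_wordSpan (hx _) (hy _)

/-- Setting X = 1 sums the homogeneous components. Evaluation at 1 is multiplicative over a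
noncommutative ring because 1 is central. -/
theorem eval_one_coaction (ht : Algebra.adjoin K (Set.range t) = ⊤)
    (hρ : ∀ i, ρ (t i) = monomial 1 (t i)) (a : S) : (ρ a).eval 1 = a := by
  have ha : a ∈ Algebra.adjoin K (Set.range t) := by rw [ht]; trivial
  induction ha using Algebra.adjoin_induction with
  | mem x hx => obtain ⟨i, rfl⟩ := hx; simp [hρ]
  | algebraMap c => rw [AlgHom.commutes, Polynomial.algebraMap_apply]; simp
  | add x y _ _ hx hy => rw [map_add, eval_add, hx, hy]
  | mul x y _ _ hx hy =>
    rw [map_mul, eval, eval₂_mul_noncomm _ _ fun k => Commute.one_right _]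
    exact congrArg₂ (· * ·) hx hy

theorem coaction_injective (ht : Algebra.adjoin K (Set.range t) = ⊤)
    (hρ : ∀ i, ρ (t i) = monomial 1 (t i)) : Function.Injective ρ :=
  Function.LeftInverse.injective (g := eval 1) (eval_one_coaction ht hρ)

theorem coeff_zero_coaction (ht : Algebra.adjoin K (Set.range t) = ⊤)
    (hρ : ∀ i, ρ (t i) = monomial 1 (t i)) {ε : S →ₐ[K] K} (hε : ∀ i, ε (t i) = 0) (a : S) :
    (ρ a).coeff 0 = algebraMap K S (ε a) := by
  have ha : a ∈ Algebra.adjoin K (Set.range t) := by rw [ht]; trivial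
  induction ha using Algebra.adjoin_induction with
  | mem x hx => obtain ⟨i, rfl⟩ := hx; simp [hρ, hε, coeff_monomial]
  | algebraMap c => simp [Polynomial.algebraMap_apply]
  | add x y _ _ hx hy => simp [hx, hy]
  | mul x y _ _ hx hy => simp [mul_coeff_zero, hx, hy]

/-- An idempotent matrix with entries of zero constant term vanishes. -/
theorem eq_zero_of_idempotent_of_coeff_zero (ht : Algebra.adjoin K (Set.range t) = ⊤)
    (hρ : ∀ i, ρ (t i) = monomial 1 (t i)) {s : ℕ} {N : Fin s → Fin s → S}
    (hN : ∀ i j, N i j = ∑ k, N i k * N k j) (h0 : ∀ i j, (ρ (N i j)).coeff 0 = 0)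
    (i j : Fin s) : N i j = 0 := by
  -- In a product of two entries the right factor has no component of degree 0, so the left one
  -- contributes only in degrees below n, where it vanishes by induction.
  have key : ∀ n i j, (ρ (N i j)).coeff n = 0 := by
    intro n
    induction n using Nat.strong_induction_on with
    | _ n ih =>
      intro i j
      rw [hN, map_sum, finsetSum_coeff]
      refine Finset.sum_eq_zero fun k _ => ?_
      rw [map_mul, coeff_mul]
      refine Finset.sum_eq_zero fun p hp => ?_
      rw [Finset.HasAntidiagonal.mem_antidiagonal] at hp
      rcases Nat.eq_zero_or_pos p.2 with h | h
      · rw [h, h0, mul_zero]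
      · rw [ih p.1 (by omega), zero_mul]
  apply coaction_injective ht hρ
  ext n
  simp [key]

end Coaction

/-! ### Freeness of the augmentation ideal of the free algebra -/

section Free

variable {K : Type u} [Field K] {m : ℕ}

/-- The augmentation of the free algebra. -/
noncomputable def freeAugmentation (K : Type u) [Field K] (m : ℕ) : FreeAlgebra K (Fin m) →ₐ[K] K :=
  FreeAlgebra.lift K fun _ => 0

@[simp] theorem freeAugmentation_ι (i : Fin m) :
    freeAugmentation K m (FreeAlgebra.ι K i) = 0 := by simp [freeAugmentation]

/-- The grading of the free algebra by word length, as a coaction. -/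
noncomputable def freeCoaction (K : Type u) [Field K] (m : ℕ) :
    FreeAlgebra K (Fin m) →ₐ[K] (FreeAlgebra K (Fin m))[X] :=
  FreeAlgebra.lift K fun i => monomial 1 (FreeAlgebra.ι K i)

@[simp] theorem freeCoaction_ι (i : Fin m) :
    freeCoaction K m (FreeAlgebra.ι K i) = monomial 1 (FreeAlgebra.ι K i) := by
  simp [freeCoaction]

/-- A representation of the free algebra that reads off left coefficients. -/
noncomputable def freeCoeffRep (K : Type u) [Field K] (m : ℕ) :
    FreeAlgebra K (Fin m) →ₐ[K] Module.End K ((Fin m → FreeAlgebra K (Fin m)) × K) :=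
  FreeAlgebra.lift K fun j =>
    LinearMap.inl K _ _ ∘ₗ
      (LinearMap.coprod (Algebra.lsmul K K (Fin m → FreeAlgebra K (Fin m)) (FreeAlgebra.ι K j))
        (LinearMap.toSpanSingleton K _ (Pi.single j 1)))

theorem freeCoeffRep_apply_inl (g : FreeAlgebra K (Fin m)) (v : Fin m → FreeAlgebra K (Fin m)) :
    freeCoeffRep K m g (v, 0) = (g • v, 0) := by
  induction g using FreeAlgebra.induction generalizing v with
  | grade0 c =>
    rw [AlgHom.commutes, Module.algebraMap_end_apply, algebraMap_smul]
    simp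
  | grade1 j => simp [freeCoeffRep]
  | mul a b ha hb => rw [map_mul, Module.End.mul_apply, hb, ha, mul_smul]
  | add a b ha hb => rw [map_add, LinearMap.add_apply, ha, hb, add_smul]; simp

/-- The augmentation ideal of the free algebra is free as a left module on the generators. -/
theorem eq_zero_of_sum_mul_ι_eq_zero {g : Fin m → FreeAlgebra K (Fin m)}
    (h : ∑ j, g j * FreeAlgebra.ι K j = 0) : g = 0 := by
  -- Each generator ι_j sends (0, 1) to (e_j, 0), and left factors then act by multiplication; so ∑
  -- g_j ι_j sends (0, 1) to (g, 0).
  have h1 := congrArg (fun a => (freeCoeffRep K m a ((0 : Fin m → FreeAlgebra K (Fin m)), (1 : K))).1) h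
  have h2 : ∀ j, freeCoeffRep K m (FreeAlgebra.ι K j) (0, 1) = (Pi.single j 1, 0) := by
    intro j
    simp [freeCoeffRep]
  simp only [map_sum, map_mul, map_zero, LinearMap.sum_apply, Module.End.mul_apply, h2,
    freeCoeffRep_apply_inl, LinearMap.zero_apply, Prod.fst_sum, Prod.fst_zero] at h1
  rw [← h1]
  ext k
  simp [Finset.sum_apply, Pi.single_apply]

theorem sum_mul_ι_injective {g h : Fin m → FreeAlgebra K (Fin m)}
    (hgh : ∑ j, g j * FreeAlgebra.ι K j = ∑ j, h j * FreeAlgebra.ι K j) : g = h := by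
  rw [← sub_eq_zero]
  apply eq_zero_of_sum_mul_ι_eq_zero
  simp [sub_mul, hgh]

end Free

/-! ### Presented algebras and their ideal of relations -/

section Ideal

variable {K : Type u} [Field K] {m s : ℕ} (r : Fin s → FreeAlgebra K (Fin m))

/-- The quotient map from the free algebra to a presented algebra. -/
noncomputable def presentedMk : FreeAlgebra K (Fin m) →ₐ[K] Presented r :=
  RingQuot.mkAlgHom K _

theorem presentedMk_surjective : Function.Surjective (presentedMk r) :=
  RingQuot.mkAlgHom_surjective K _

@[simp] theorem presentedMk_ι (k : Fin m) : presentedMk r (FreeAlgebra.ι K k) = gen r k := rfl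

@[simp] theorem presentedMk_relation (i : Fin s) : presentedMk r (r i) = 0 := by
  rw [← map_zero (presentedMk r)]
  exact RingQuot.mkAlgHom_rel K ⟨⟨i, rfl⟩, rfl⟩

/-- The universal property of a presented algebra. -/
noncomputable def presentedLift {B : Type v} [Ring B] [Algebra K B]
    (f : FreeAlgebra K (Fin m) →ₐ[K] B) (hf : ∀ i, f (r i) = 0) : Presented r →ₐ[K] B :=
  RingQuot.liftAlgHom K ⟨f, by rintro a b ⟨⟨i, rfl⟩, rfl⟩; rw [hf, map_zero]⟩

@[simp] theorem presentedLift_mk {B : Type v} [Ring B] [Algebra K B]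
    (f : FreeAlgebra K (Fin m) →ₐ[K] B) (hf : ∀ i, f (r i) = 0) (a : FreeAlgebra K (Fin m)) :
    presentedLift r f hf (presentedMk r a) = f a :=
  RingQuot.liftAlgHom_mkAlgHom_apply K f _ a

@[simp] theorem presentedLift_gen {B : Type v} [Ring B] [Algebra K B]
    (f : FreeAlgebra K (Fin m) →ₐ[K] B) (hf : ∀ i, f (r i) = 0) (k : Fin m) :
    presentedLift r f hf (gen r k) = f (FreeAlgebra.ι K k) :=
  presentedLift_mk r f hf _

theorem presentedMk_eq_zero_iff {a : FreeAlgebra K (Fin m)} :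
    presentedMk r a = 0 ↔ a ∈ TwoSidedIdeal.span (Set.range r) := by
  constructor
  · intro h
    let J := TwoSidedIdeal.span (Set.range r)
    -- The quotient by the ideal satisfies the relations, so the presented algebra maps to it
    -- compatibly with the free algebra.
    have h2 := presentedLift_mk r (J.ringCon.mkₐ K) (fun i => by
      have : r i ∈ J := TwoSidedIdeal.subset_span ⟨i, rfl⟩
      rw [TwoSidedIdeal.mem_iff] at this
      exact (RingCon.eq _).2 this) a
    rw [h, map_zero] at h2
    rw [TwoSidedIdeal.mem_iff]
    exact (RingCon.eq _).1 h2.symm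
  · intro h
    have : TwoSidedIdeal.span (Set.range r) ≤ TwoSidedIdeal.ker (presentedMk r) := by
      rw [TwoSidedIdeal.span_le]
      rintro _ ⟨i, rfl⟩
      exact (TwoSidedIdeal.mem_ker _).2 (presentedMk_relation r i)
    exact (TwoSidedIdeal.mem_ker _).1 (this h)

theorem presentedMk_induction {P : FreeAlgebra K (Fin m) → Prop} (h0 : P 0)
    (hrel : ∀ i, P (r i)) (hadd : ∀ a b, P a → P b → P (a + b)) (hneg : ∀ a, P a → P (-a))
    (hleft : ∀ a b, P b → P (a * b)) (hright : ∀ a b, P a → P (a * b))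
    {a : FreeAlgebra K (Fin m)} (ha : presentedMk r a = 0) : P a := by
  rw [presentedMk_eq_zero_iff] at ha
  have : TwoSidedIdeal.span (Set.range r) ≤ TwoSidedIdeal.mk' {a | P a} h0 (hadd _ _) (hneg _)
      (hleft _ _) (hright _ _) := by
    rw [TwoSidedIdeal.span_le]
    rintro _ ⟨i, rfl⟩
    exact (TwoSidedIdeal.mem_mk' ..).2 (hrel i)
  exact (TwoSidedIdeal.mem_mk' ..).1 (this ha)

end Ideal

end SkewPBW

namespace SkewPBW

open Polynomial

/-! ### Syzygies of a homogeneous presentation -/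

section Homogeneous

variable {K : Type u} [Field K] {m s : ℕ} {r : Fin s → FreeAlgebra K (Fin m)} {d : Fin s → ℕ}

theorem IsHomogeneousPresentation.coaction_relation (hr : IsHomogeneousPresentation r d)
    (i : Fin s) : freeCoaction K m (r i) = monomial (d i) (r i) :=
  coaction_of_mem_wordSpan freeCoaction_ι (hr.homogeneous i)

theorem IsHomogeneousPresentation.augmentation_relation (hr : IsHomogeneousPresentation r d)
    (i : Fin s) : freeAugmentation K m (r i) = 0 := by
  have h := coeff_zero_coaction (FreeAlgebra.adjoin_range_ι K (Fin m)) freeCoaction_ι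
    (freeAugmentation_ι (K := K) (m := m)) (r i)
  rw [hr.coaction_relation, coeff_monomial, if_neg (by have := hr.two_le i; omega)] at h
  exact (map_eq_zero_iff _ (FreeAlgebra.algebraMap_leftInverse (R := K)
    (X := Fin m)).injective).1 h.symm

theorem IsHomogeneousPresentation.exists_augmentation (hr : IsHomogeneousPresentation r d) :
    ∃ ε : Presented r →ₐ[K] K, (∀ a, ε (presentedMk r a) = freeAugmentation K m a) ∧
      ∀ i, ε (gen r i) = 0 :=
  ⟨presentedLift r (freeAugmentation K m) hr.augmentation_relation, presentedLift_mk r _ _,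
    fun i => by simp⟩

theorem IsHomogeneousPresentation.exists_coaction (hr : IsHomogeneousPresentation r d) :
    ∃ ρ : Presented r →ₐ[K] (Presented r)[X], ∀ i, ρ (gen r i) = monomial 1 (gen r i) := by
  have h : (FreeAlgebra.lift K fun i => (monomial 1 (gen r i) : (Presented r)[X])) =
      (mapAlgHom (presentedMk r)).comp (freeCoaction K m) := by
    ext i
    simp
  refine ⟨presentedLift r (FreeAlgebra.lift K fun i => monomial 1 (gen r i)) fun i => ?_,
    fun i => by simp⟩
  rw [h, AlgHom.comp_apply, hr.coaction_relation]
  simp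

/-- These coefficients form the matrix of the second differential in the resolution of the trivial
module. Since d_i ≥ 2, the truncated subtraction d_i - 1 is a true one and is at least 1. -/
theorem IsHomogeneousPresentation.exists_left_coefficients (hr : IsHomogeneousPresentation r d) :
    ∃ q : Fin s → Fin m → FreeAlgebra K (Fin m),
      (∀ i j, q i j ∈ wordSpan K (FreeAlgebra.ι K) (d i - 1)) ∧
        ∀ i, r i = ∑ j, q i j * FreeAlgebra.ι K j := by
  have h : ∀ i, ∃ g : Fin m → FreeAlgebra K (Fin m),
      (∀ j, g j ∈ wordSpan K (FreeAlgebra.ι K) (d i - 1)) ∧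
        r i = ∑ j, g j * FreeAlgebra.ι K j := fun i => by
    apply exists_eq_sum_mul_of_mem_wordSpan_succ
    have h2 := hr.two_le i
    rw [show d i - 1 + 1 = d i by omega]
    exact hr.homogeneous i
  choose q hq hq' using h
  exact ⟨q, hq, hq'⟩

/-- An element of the ideal of relations is a left combination of the relations modulo the left
multiples of the generators by elements of the ideal. -/
theorem exists_decomposition_of_presentedMk_eq_zero {f : FreeAlgebra K (Fin m)}
    (hf : presentedMk r f = 0) :
    ∃ (b : Fin s → FreeAlgebra K (Fin m)) (g : Fin m → FreeAlgebra K (Fin m)),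
      (∀ j, presentedMk r (g j) = 0) ∧
        f = ∑ i, b i * r i + ∑ j, g j * FreeAlgebra.ι K j := by
  suffices h : presentedMk r f = 0 ∧ ∃ (b : Fin s → FreeAlgebra K (Fin m))
      (g : Fin m → FreeAlgebra K (Fin m)), (∀ j, presentedMk r (g j) = 0) ∧
        f = ∑ i, b i * r i + ∑ j, g j * FreeAlgebra.ι K j from h.2
  refine presentedMk_induction r
    (P := fun f => presentedMk r f = 0 ∧ ∃ (b : Fin s → FreeAlgebra K (Fin m))
      (g : Fin m → FreeAlgebra K (Fin m)), (∀ j, presentedMk r (g j) = 0) ∧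
        f = ∑ i, b i * r i + ∑ j, g j * FreeAlgebra.ι K j)
    ⟨map_zero _, 0, 0, by simp, by simp⟩ (fun i => ⟨by simp, Pi.single i 1, 0, by simp, by
      simp [Pi.single_apply]⟩) ?_ ?_ ?_ ?_ hf
  · rintro _ _ ⟨h1, b, g, hg, rfl⟩ ⟨h2, b', g', hg', rfl⟩
    refine ⟨by rw [map_add, h1, h2, add_zero], b + b', g + g', fun j => by simp [hg, hg'], ?_⟩
    simp only [Pi.add_apply, add_mul, Finset.sum_add_distrib]
    abel
  · rintro _ ⟨h1, b, g, hg, rfl⟩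
    refine ⟨by rw [map_neg, h1, neg_zero], -b, -g, fun j => by simp [hg], ?_⟩
    simp only [Pi.neg_apply, neg_mul, Finset.sum_neg_distrib]
    abel
  · rintro a _ ⟨h1, b, g, hg, rfl⟩
    refine ⟨by rw [map_mul, h1, mul_zero], fun i => a * b i, fun j => a * g j,
      fun j => by simp [hg], ?_⟩
    simp only [mul_add, Finset.mul_sum, mul_assoc]
  · rintro a c ⟨h1, b, g, hg, h2⟩
    refine ⟨by rw [map_mul, h1, zero_mul], ?_⟩
    obtain ⟨e, he⟩ := exists_eq_augmentation_add_sum (FreeAlgebra.adjoin_range_ι K (Fin m))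
      (freeAugmentation K m) freeAugmentation_ι c
    -- Write c = ε(c) + ∑ e_j t_j. The scalar rescales the given decomposition of a, while the rest
    -- contributes the coefficients a e_j, which lie in the ideal because a does.
    refine ⟨fun i => freeAugmentation K m c • b i,
      fun j => freeAugmentation K m c • g j + a * e j, fun j => by simp [hg, h1], ?_⟩
    have h3 : freeAugmentation K m c • a = ∑ i, (freeAugmentation K m c • b i) * r i +
        ∑ j, (freeAugmentation K m c • g j) * FreeAlgebra.ι K j := by
      conv_lhs => rw [h2]
      simp only [smul_add, Finset.smul_sum, smul_mul_assoc]
    conv_lhs => rw [he, mul_add, ← Algebra.commutes, ← Algebra.smul_def, h3]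
    simp only [Finset.mul_sum, add_mul, Finset.sum_add_distrib, mul_assoc, add_assoc]

variable {q : Fin s → Fin m → FreeAlgebra K (Fin m)}

/-- The left syzygies of the generators are generated by the left coefficients of the
relations. -/
theorem exists_of_sum_mul_gen_eq_zero (hq : ∀ i, r i = ∑ j, q i j * FreeAlgebra.ι K j)
    {a : Fin m → Presented r} (ha : ∑ j, a j * gen r j = 0) :
    ∃ b : Fin s → Presented r, ∀ j, a j = ∑ i, b i * presentedMk r (q i j) := by
  choose a' ha' using fun j => presentedMk_surjective r (a j)
  obtain ⟨b, g, hg, h⟩ := exists_decomposition_of_presentedMk_eq_zero (r := r)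
    (f := ∑ j, a' j * FreeAlgebra.ι K j) (by simp [ha', ha])
  refine ⟨fun i => presentedMk r (b i), fun j => ?_⟩
  -- The augmentation ideal is free on the generators, so their left coefficients can be compared in
  -- the free algebra.
  have h2 : a' = fun j => ∑ i, b i * q i j + g j := by
    apply sum_mul_ι_injective
    rw [h]
    simp only [hq, Finset.mul_sum, add_mul, Finset.sum_mul, Finset.sum_add_distrib, mul_assoc]
    rw [Finset.sum_comm]
  rw [← ha', h2]
  simp [hg]

theorem sum_mul_leftCoeff_mul_gen (hq : ∀ i, r i = ∑ j, q i j * FreeAlgebra.ι K j)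
    (i : Fin s) : ∑ j, presentedMk r (q i j) * gen r j = 0 := by
  have := presentedMk_relation r i
  rw [hq i] at this
  simpa using this

/-- The elements of the ideal of relations have no components of degree less than `n` modulo an
ideal that contains the relations of degree less than `n`. -/
theorem IsHomogeneousPresentation.coeff_coaction_mem (hr : IsHomogeneousPresentation r d)
    (J : TwoSidedIdeal (FreeAlgebra K (Fin m))) (n : ℕ) (hJ : ∀ i, d i < n → r i ∈ J)
    {f : FreeAlgebra K (Fin m)} (hf : presentedMk r f = 0) {k : ℕ} (hk : k < n) :
    (freeCoaction K m f).coeff k ∈ J := by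
  revert k
  refine presentedMk_induction r
    (P := fun f => ∀ {k}, k < n → (freeCoaction K m f).coeff k ∈ J)
    (fun _ => by simp) ?_ ?_ ?_ ?_ ?_ hf
  · intro i k hk
    rw [hr.coaction_relation, coeff_monomial]
    split_ifs with h
    · exact hJ i (by omega)
    · exact J.zero_mem
  · intro a b ha hb k hk
    rw [map_add, coeff_add]
    exact J.add_mem (ha hk) (hb hk)
  · intro a ha k hk
    rw [map_neg, coeff_neg]
    exact J.neg_mem (ha hk)
  · intro a b hb k hk
    rw [map_mul, coeff_mul]
    refine sum_mem fun p hp => J.mul_mem_left _ _ (hb ?_)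
    have := Finset.HasAntidiagonal.mem_antidiagonal.1 hp
    omega
  · intro a b ha k hk
    rw [map_mul, coeff_mul]
    refine sum_mem fun p hp => J.mul_mem_right _ _ (ha ?_)
    have := Finset.HasAntidiagonal.mem_antidiagonal.1 hp
    omega

/-- All relations have degree at least 2, so the ideal of relations has no component of degree 1;
this is the case of the zero ideal and n = 2 above. -/
theorem IsHomogeneousPresentation.linearIndependent_gen (hr : IsHomogeneousPresentation r d) :
    LinearIndependent K (gen r) := by
  refine Fintype.linearIndependent_iff.2 fun c hc j => ?_
  have h := hr.coeff_coaction_mem ⊥ 2 (fun i hi => absurd (hr.two_le i) (by omega))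
    (f := ∑ j, c j • FreeAlgebra.ι K j) (by simpa using hc) one_lt_two
  have h1 : ∑ j, c j • FreeAlgebra.ι K j ∈ wordSpan K (FreeAlgebra.ι K (X := Fin m)) 1 :=
    sum_mem fun j _ => Submodule.smul_mem _ _ (generator_mem_wordSpan_one j)
  rw [coaction_of_mem_wordSpan freeCoaction_ι h1, coeff_monomial, if_pos rfl,
    TwoSidedIdeal.mem_bot] at h
  have h2 := eq_zero_of_sum_mul_ι_eq_zero (g := fun j => algebraMap K _ (c j))
    (by simpa [Algebra.smul_def] using h)
  exact (map_eq_zero_iff _ (FreeAlgebra.algebraMap_leftInverse (R := K)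
    (X := Fin m)).injective).1 (congrFun h2 j)

/-- By minimality of the system of relations, the syzygies between the left coefficients of the
relations have coefficients of zero augmentation. -/
theorem IsHomogeneousPresentation.augmentation_eq_zero_of_syzygy
    (hr : IsHomogeneousPresentation r d) (hq : ∀ i, r i = ∑ j, q i j * FreeAlgebra.ι K j)
    {b : Fin s → FreeAlgebra K (Fin m)} (hb : ∀ j, presentedMk r (∑ i, b i * q i j) = 0)
    (i₀ : Fin s) : freeAugmentation K m (b i₀) = 0 := by
  by_contra hne
  apply hr.minimal i₀
  set J := TwoSidedIdeal.span (r '' {j | j ≠ i₀})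
  have hJ : ∀ i, i ≠ i₀ → r i ∈ J := fun i hi => TwoSidedIdeal.subset_span ⟨i, hi, rfl⟩
  have h1 : ∑ i, b i * r i = ∑ j, (∑ i, b i * q i j) * FreeAlgebra.ι K j := by
    simp only [Finset.sum_mul, hq, Finset.mul_sum, mul_assoc]
    rw [Finset.sum_comm]
  -- Compare components in degree d_{i₀}. On the right, the factor t_j leaves components of ideal
  -- elements in degree d_{i₀} - 1, which involve only relations of smaller degree. On the left,
  -- r_{i₀} appears only with the scalar ε(b_{i₀}). If that scalar were nonzero, r_{i₀} would lie in
  -- the ideal of the other relations.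
  have h2 := congrArg (fun a => (freeCoaction K m a).coeff (d i₀)) h1
  have h3 : (freeCoaction K m (∑ j, (∑ i, b i * q i j) * FreeAlgebra.ι K j)).coeff (d i₀) ∈ J := by
    rw [map_sum, finsetSum_coeff]
    refine sum_mem fun j _ => ?_
    have h2 := hr.two_le i₀
    rw [map_mul, freeCoaction_ι, show d i₀ = (d i₀ - 1) + 1 by omega, coeff_mul_monomial]
    refine J.mul_mem_right _ _ (hr.coeff_coaction_mem J (d i₀) (fun i hi => hJ i ?_) (hb j)
      (by omega))
    rintro rfl
    omega
  have h4 : (freeCoaction K m (∑ i, b i * r i)).coeff (d i₀) =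
      algebraMap K _ (freeAugmentation K m (b i₀)) * r i₀ +
        ∑ i ∈ Finset.univ.erase i₀, (freeCoaction K m (b i * r i)).coeff (d i₀) := by
    rw [map_sum, finsetSum_coeff, ← Finset.add_sum_erase _ _ (Finset.mem_univ i₀), map_mul,
      hr.coaction_relation, ← coeff_zero_coaction (FreeAlgebra.adjoin_range_ι K (Fin m))
        freeCoaction_ι freeAugmentation_ι]
    congr 1
    simpa using coeff_mul_monomial (freeCoaction K m (b i₀)) (d i₀) 0 (r i₀)
  have h5 : ∑ i ∈ Finset.univ.erase i₀, (freeCoaction K m (b i * r i)).coeff (d i₀) ∈ J := by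
    refine sum_mem fun i hi => ?_
    rw [map_mul, hr.coaction_relation, coeff_mul]
    refine sum_mem fun p _ => J.mul_mem_left _ _ ?_
    rw [coeff_monomial]
    split_ifs
    · exact hJ i (Finset.ne_of_mem_erase hi)
    · exact J.zero_mem
  beta_reduce at h2
  rw [← h2, h4] at h3
  have h6 := J.sub_mem h3 h5
  rw [add_sub_cancel_right] at h6
  have h7 := J.mul_mem_left (algebraMap K _ (freeAugmentation K m (b i₀))⁻¹) _ h6
  rwa [← mul_assoc, ← map_mul, inv_mul_cancel₀ hne, map_one, one_mul] at h7

end Homogeneous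

end SkewPBW

namespace SkewPBW

open CategoryTheory

/-! ### Projective dimension and Ext² through a presentation -/

section Homology

variable {A : Type u} [Ring A]

/-- The short complex `0 → I → A → A / I → 0`. -/
abbrev idealShortComplex (I : Ideal A) : ShortComplex (ModuleCat.{u} A) where
  f := ModuleCat.ofHom (Submodule.subtype I)
  g := ModuleCat.ofHom (Submodule.mkQ I)
  zero := by ext x; simp

theorem idealShortComplex_shortExact (I : Ideal A) : (idealShortComplex I).ShortExact where
  exact := (ShortComplex.ShortExact.moduleCat_exact_iff_function_exact _).mpr fun x => by simp
  mono_f := (ModuleCat.mono_iff_injective _).2 Subtype.val_injective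
  epi_g := (ModuleCat.epi_iff_surjective _).2 (Submodule.mkQ_surjective I)

/-- Dimension shifting along 0 → I → A → A/I → 0 and 0 → ker φ → M → I → 0, whose middle terms are
projective. -/
theorem projective_ker_of_hasProjectiveDimensionLE_two (I : Ideal A)
    (h : HasProjectiveDimensionLE (ModuleCat.of A (A ⧸ I)) 2) {M : Type u} [AddCommGroup M]
    [Module A M] [Module.Projective A M] (φ : M →ₗ[A] I) (hφ : Function.Surjective φ) :
    Module.Projective A (LinearMap.ker φ) := by
  have hA : Projective (ModuleCat.of A A) := (IsProjective.iff_projective A).1 inferInstance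
  have hM : Projective (ModuleCat.of A M) := (IsProjective.iff_projective M).1 inferInstance
  have h1 : HasProjectiveDimensionLT (ModuleCat.of A I) 2 :=
    ((idealShortComplex_shortExact I).hasProjectiveDimensionLT_X₃_iff 1 hA).1 h
  have h2 : HasProjectiveDimensionLT (ModuleCat.of A (LinearMap.ker φ)) 1 :=
    ((LinearMap.shortExact_shortComplexKer hφ).hasProjectiveDimensionLT_X₃_iff 0 hM).1 h1
  exact (IsProjective.iff_projective _).2 (projective_iff_hasProjectiveDimensionLT_one.2 h2)

open Abelian in
/-- A projective presentation of `A / I` of length two computes `Ext²`. -/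
theorem exists_linearMap_of_ext_two {K : Type u} [Field K] [Algebra K A] (I : Ideal A)
    {M : Type u} [AddCommGroup M] [Module A M] [Module.Projective A M] (φ : M →ₗ[A] I)
    (hφ : Function.Surjective φ)
    (e : Ext (ModuleCat.of A (A ⧸ I)) (ModuleCat.of A A) 2 ≃ₗ[K] K) :
    ∃ Λ : (LinearMap.ker φ →ₗ[A] A) →+ K,
      (∀ (c : K) f g, (∀ x, g x = algebraMap K A c * f x) → Λ g = c * Λ f) ∧
      Function.Surjective Λ ∧
      ∀ f, Λ f = 0 ↔ ∃ g : M →ₗ[A] A, f = g ∘ₗ (LinearMap.ker φ).subtype := by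
  have hA : Projective (ModuleCat.of A A) := (IsProjective.iff_projective A).1 inferInstance
  have hM : Projective (ModuleCat.of A M) := (IsProjective.iff_projective M).1 inferInstance
  have h1 := idealShortComplex_shortExact I
  have h2 := LinearMap.shortExact_shortComplexKer hφ
  -- The composite of the two connecting maps Hom(ker φ, A) → Ext¹(I, A) → Ext²(A/I, A).
  let γ : Ext (ModuleCat.of A (LinearMap.ker φ)) (ModuleCat.of A A) 0 →+
      Ext (ModuleCat.of A (A ⧸ I)) (ModuleCat.of A A) 2 :=
    (h1.extClass.precomp (ModuleCat.of A A) one_add_one_eq_two).comp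
      (h2.extClass.precomp (ModuleCat.of A A) (add_zero 1))
  have hγ_smul : ∀ (c : K) x, γ (c • x) = c • γ x := fun c x => by
    change h1.extClass.comp (h2.extClass.comp (c • x) (add_zero 1)) one_add_one_eq_two =
      c • h1.extClass.comp (h2.extClass.comp x (add_zero 1)) one_add_one_eq_two
    rw [Ext.comp_smul, Ext.comp_smul]
  -- The obstructions to lifting lie in Ext²(A, A) and Ext¹(M, A), which vanish.
  have hγ_surj : Function.Surjective γ := fun x => by
    obtain ⟨y, rfl⟩ := Ext.contravariant_sequence_exact₃ h1 _ x
      (Ext.eq_zero_of_projective _) one_add_one_eq_two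
    obtain ⟨z, rfl⟩ := Ext.contravariant_sequence_exact₃ h2 _ y
      (Ext.eq_zero_of_projective _) (add_zero 1)
    exact ⟨z, rfl⟩
  -- The second connecting map is injective because Ext¹(A, A) = 0, so the kernel is that of the
  -- first: the maps that extend to M.
  have hγ_ker : ∀ x, γ x = 0 ↔ ∃ y : Ext (ModuleCat.of A M) (ModuleCat.of A A) 0,
      (Ext.mk₀ φ.shortComplexKer.f).comp y (zero_add 0) = x := fun x => by
    constructor
    · intro hx
      obtain ⟨y, hy⟩ := Ext.contravariant_sequence_exact₁ h1 _ _ one_add_one_eq_two hx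
      rw [Ext.eq_zero_of_projective y, Ext.comp_zero] at hy
      exact Ext.contravariant_sequence_exact₁ h2 _ _ (add_zero 1) hy.symm
    · rintro ⟨y, rfl⟩
      change h1.extClass.comp (h2.extClass.comp _ (add_zero 1)) one_add_one_eq_two = 0
      rw [ShortComplex.ShortExact.extClass_comp_assoc, Ext.comp_zero]
  let μ : (LinearMap.ker φ →ₗ[A] A) →+
      Ext (ModuleCat.of A (LinearMap.ker φ)) (ModuleCat.of A A) 0 :=
    { toFun f := Ext.mk₀ (ModuleCat.ofHom f)
      map_zero' := Ext.mk₀_zero _ _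
      map_add' f g := Ext.mk₀_add _ _ }
  have hμ_surj : Function.Surjective μ := fun x => by
    obtain ⟨f, rfl⟩ := Ext.mk₀_bijective _ _ |>.2 x
    exact ⟨f.hom, rfl⟩
  refine ⟨(e : _ →+ K).comp (γ.comp μ), ?_, ?_, ?_⟩
  · intro c f g hg
    have : μ g = c • μ f := by
      change Ext.mk₀ _ = c • Ext.mk₀ _
      rw [← Ext.mk₀_smul]
      congr 1
      ext x
      exact hg x
    change e (γ (μ g)) = c * e (γ (μ f))
    rw [this, hγ_smul, map_smul, smul_eq_mul]
  · exact e.surjective.comp (hγ_surj.comp hμ_surj)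
  · intro f
    change e (γ (μ f)) = 0 ↔ _
    rw [map_eq_zero_iff e e.injective, hγ_ker]
    constructor
    · rintro ⟨y, hy⟩
      obtain ⟨g, rfl⟩ := Ext.mk₀_bijective _ _ |>.2 y
      rw [Ext.mk₀_comp_mk₀] at hy
      exact ⟨g.hom, (congrArg ModuleCat.Hom.hom (Ext.mk₀_bijective _ _ |>.1 hy)).symm⟩
    · rintro ⟨g, rfl⟩
      refine ⟨Ext.mk₀ (ModuleCat.ofHom g), ?_⟩
      rw [Ext.mk₀_comp_mk₀]
      rfl

end Homology

end SkewPBW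

namespace SkewPBW

open Polynomial

/-! ### The resolution of the trivial module and the number of relations -/

section Regular

variable {K : Type u} [Field K] {m s : ℕ} {r : Fin s → FreeAlgebra K (Fin m)} {d : Fin s → ℕ}
  {q : Fin s → Fin m → FreeAlgebra K (Fin m)}

/-- The map from the free module on the generators onto the augmentation ideal. -/
noncomputable def generatorMap (r : Fin s → FreeAlgebra K (Fin m)) :
    (Fin m → Presented r) →ₗ[Presented r] Ideal.span (Set.range (gen r)) :=
  (Fintype.linearCombination (Presented r) (gen r)).codRestrict _ fun v => by
    rw [Fintype.linearCombination_apply]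
    exact sum_mem fun j _ => Ideal.mul_mem_left _ _ (Ideal.subset_span ⟨j, rfl⟩)

theorem coe_generatorMap (v : Fin m → Presented r) :
    (generatorMap r v : Presented r) = ∑ j, v j * gen r j := by
  simp [generatorMap, Fintype.linearCombination_apply]

theorem generatorMap_surjective : Function.Surjective (generatorMap r) := by
  rintro ⟨a, ha⟩
  obtain ⟨v, hv⟩ := (Submodule.mem_span_range_iff_exists_fun (Presented r)).1 ha
  exact ⟨v, Subtype.ext ((coe_generatorMap v).trans hv)⟩

/-- The map from the free module on the relations onto the syzygies of the generators. -/
noncomputable def relationMap (hq : ∀ i, r i = ∑ j, q i j * FreeAlgebra.ι K j) :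
    (Fin s → Presented r) →ₗ[Presented r] LinearMap.ker (generatorMap r) :=
  (Fintype.linearCombination (Presented r) fun i j => presentedMk r (q i j)).codRestrict _
    fun v => by
      rw [LinearMap.mem_ker, Fintype.linearCombination_apply, map_sum]
      refine Finset.sum_eq_zero fun i _ => ?_
      rw [map_smul]
      convert smul_zero (v i)
      exact Subtype.ext ((coe_generatorMap _).trans (sum_mul_leftCoeff_mul_gen hq i))

theorem coe_relationMap (hq : ∀ i, r i = ∑ j, q i j * FreeAlgebra.ι K j)
    (v : Fin s → Presented r) (j : Fin m) :
    (relationMap hq v : Fin m → Presented r) j = ∑ i, v i * presentedMk r (q i j) := by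
  simp [relationMap, Fintype.linearCombination_apply]

theorem relationMap_surjective (hq : ∀ i, r i = ∑ j, q i j * FreeAlgebra.ι K j) :
    Function.Surjective (relationMap hq) := by
  rintro ⟨a, ha⟩
  obtain ⟨b, hb⟩ := exists_of_sum_mul_gen_eq_zero hq (a := a) (by
    rw [← coe_generatorMap, LinearMap.mem_ker.1 ha]; rfl)
  refine ⟨b, Subtype.ext (funext fun j => ?_)⟩
  rw [coe_relationMap, ← hb]

theorem IsHomogeneousPresentation.augmentation_eq_zero_of_relationMap_eq_zero
    (hr : IsHomogeneousPresentation r d) (hq : ∀ i, r i = ∑ j, q i j * FreeAlgebra.ι K j)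
    {ε : Presented r →ₐ[K] K} (hε : ∀ a, ε (presentedMk r a) = freeAugmentation K m a)
    {v : Fin s → Presented r} (hv : relationMap hq v = 0) (i : Fin s) : ε (v i) = 0 := by
  choose b hb using fun i => presentedMk_surjective r (v i)
  rw [← hb, hε]
  refine hr.augmentation_eq_zero_of_syzygy hq (fun j => ?_) i
  rw [map_sum]
  simp only [map_mul, hb]
  rw [← coe_relationMap hq, hv]
  rfl

/-- If the syzygies of the generators form a projective module, then they are freely generated by
the relations. -/
theorem IsHomogeneousPresentation.relationMap_injective (hr : IsHomogeneousPresentation r d)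
    (hq : ∀ i, r i = ∑ j, q i j * FreeAlgebra.ι K j)
    (hproj : Module.Projective (Presented r) (LinearMap.ker (generatorMap r))) :
    Function.Injective (relationMap hq) := by
  obtain ⟨ε, hε, hε_gen⟩ := hr.exists_augmentation
  obtain ⟨ρ, hρ⟩ := hr.exists_coaction
  obtain ⟨σ, hσ⟩ := Module.projective_lifting_property (relationMap hq) LinearMap.id
    (relationMap_surjective hq)
  have hσ' : ∀ x, relationMap hq (σ x) = x := LinearMap.congr_fun hσ
  -- For a section σ of the surjection, this is the idempotent projecting onto the kernel. Its
  -- matrix rows are syzygies, so by minimality all entries have zero augmentation, and an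
  -- idempotent matrix of this kind is zero.
  let n : (Fin s → Presented r) →ₗ[Presented r] (Fin s → Presented r) :=
    LinearMap.id - σ ∘ₗ relationMap hq
  have hn : ∀ v, relationMap hq (n v) = 0 := fun v => by
    simp only [n, LinearMap.sub_apply, LinearMap.id_apply, LinearMap.comp_apply, map_sub, hσ',
      sub_self]
  have hn2 : ∀ v, n (n v) = n v := fun v => by
    change n v - σ (relationMap hq (n v)) = n v
    rw [hn, map_zero, sub_zero]
  have hsum : ∀ v j, n v j = ∑ i, v i * n (Pi.single i 1) j := fun v j => by
    conv_lhs => rw [← Finset.univ_sum_single v, map_sum, Finset.sum_apply]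
    refine Finset.sum_congr rfl fun i _ => ?_
    rw [show (Pi.single i (v i) : Fin s → Presented r) = v i • Pi.single i 1 by
      rw [← Pi.single_smul, smul_eq_mul, mul_one], map_smul]
    rfl
  have hzero : ∀ i j, n (Pi.single i 1) j = 0 := by
    refine eq_zero_of_idempotent_of_coeff_zero (adjoin_gen r) hρ (fun i j => ?_) fun i j => ?_
    · conv_lhs => rw [← hn2]
      exact hsum _ _
    · rw [coeff_zero_coaction (adjoin_gen r) hρ hε_gen,
        hr.augmentation_eq_zero_of_relationMap_eq_zero hq hε (hn _), map_zero]
  refine (injective_iff_map_eq_zero (relationMap hq)).2 fun v hv => ?_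
  have h1 : n v = v := by simp [n, hv]
  rw [← h1]
  ext j
  rw [hsum]
  simp [hzero]

/-- `Ext²(K, R)` as the cokernel of the transpose of the matrix of left coefficients of the
relations. -/
theorem exists_addMonoidHom_of_ext_two (hq : ∀ i, r i = ∑ j, q i j * FreeAlgebra.ι K j)
    (hinj : Function.Injective (relationMap hq))
    (hext : Nonempty (CategoryTheory.Abelian.Ext (trivialModule r)
      (ModuleCat.of (Presented r) (Presented r)) 2 ≃ₗ[K] K)) :
    ∃ Λ : (Fin s → Presented r) →+ K,
      (∀ (c : K) v, Λ (fun i => algebraMap K (Presented r) c * v i) = c * Λ v) ∧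
      Function.Surjective Λ ∧
      ∀ v, Λ v = 0 ↔ ∃ w : Fin m → Presented r, ∀ i, v i = ∑ j, presentedMk r (q i j) * w j := by
  obtain ⟨e⟩ := hext
  obtain ⟨Λ, h1, h2, h3⟩ := exists_linearMap_of_ext_two (K := K) _ (generatorMap r)
    generatorMap_surjective e
  let Ψ := LinearEquiv.ofBijective (relationMap hq) ⟨hinj, relationMap_surjective hq⟩
  -- The syzygy module is free on the relations, so v corresponds to the functional b ↦ ∑ b_i v_i.
  let T : (Fin s → Presented r) →+ (LinearMap.ker (generatorMap r) →ₗ[Presented r] Presented r) :=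
    { toFun v := Fintype.linearCombination (Presented r) v ∘ₗ Ψ.symm.toLinearMap
      map_zero' := by ext; simp [Fintype.linearCombination_apply]
      map_add' v w := by
        ext
        simp [Fintype.linearCombination_apply, mul_add, Finset.sum_add_distrib] }
  have hT : ∀ v b, T v (relationMap hq b) = ∑ i, b i * v i := fun v b => by
    have : Ψ.symm (relationMap hq b) = b := Ψ.symm_apply_apply b
    simp [T, this, Fintype.linearCombination_apply]
  refine ⟨Λ.comp T, fun c v => h1 c _ _ fun x => ?_, fun c => ?_, fun v => ?_⟩
  · obtain ⟨b, rfl⟩ := relationMap_surjective hq x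
    rw [hT, hT, Finset.mul_sum]
    refine Finset.sum_congr rfl fun i _ => ?_
    rw [← mul_assoc, ← Algebra.commutes, mul_assoc]
  · obtain ⟨f, rfl⟩ := h2 c
    refine ⟨fun i => f (relationMap hq (Pi.single i 1)), congrArg Λ (LinearMap.ext fun x => ?_)⟩
    obtain ⟨b, rfl⟩ := relationMap_surjective hq x
    rw [hT]
    conv_rhs => rw [← Finset.univ_sum_single b, map_sum, map_sum]
    refine Finset.sum_congr rfl fun i _ => ?_
    rw [show (Pi.single i (b i) : Fin s → Presented r) = b i • Pi.single i 1 by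
      rw [← Pi.single_smul, smul_eq_mul, mul_one], map_smul, map_smul, smul_eq_mul]
  · rw [AddMonoidHom.comp_apply, h3]
    have hg : ∀ (g : (Fin m → Presented r) →ₗ[Presented r] Presented r) (y : Fin m → Presented r),
        g y = ∑ j, y j * g (Pi.single j 1) := fun g y => by
      conv_lhs => rw [← Finset.univ_sum_single y, map_sum]
      refine Finset.sum_congr rfl fun j _ => ?_
      rw [show (Pi.single j (y j) : Fin m → Presented r) = y j • Pi.single j 1 by
        rw [← Pi.single_smul, smul_eq_mul, mul_one], map_smul, smul_eq_mul]
    constructor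
    · rintro ⟨g, hg'⟩
      refine ⟨fun j => g (Pi.single j 1), fun i => ?_⟩
      have h4 := LinearMap.congr_fun hg' (relationMap hq (Pi.single i 1))
      rw [hT, LinearMap.comp_apply, hg] at h4
      simpa [coe_relationMap, Pi.single_apply] using h4
    · rintro ⟨w, hw⟩
      refine ⟨Fintype.linearCombination (Presented r) w, LinearMap.ext fun x => ?_⟩
      obtain ⟨b, rfl⟩ := relationMap_surjective hq x
      rw [hT, LinearMap.comp_apply, Fintype.linearCombination_apply]
      simp only [Submodule.subtype_apply, coe_relationMap, hw, Finset.mul_sum, smul_eq_mul,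
        Finset.sum_mul, mul_assoc]
      exact Finset.sum_comm

theorem IsASRegular.projective_ker_generatorMap (hreg : IsASRegular r 2) :
    Module.Projective (Presented r) (LinearMap.ker (generatorMap r)) :=
  projective_ker_of_hasProjectiveDimensionLE_two _
    ((CategoryTheory.projectiveDimension_le_iff _ _).1 hreg.gldim.le) _ generatorMap_surjective

theorem IsHomogeneousPresentation.augmentation_leftCoeff (hr : IsHomogeneousPresentation r d)
    (hq : ∀ i j, q i j ∈ wordSpan K (FreeAlgebra.ι K) (d i - 1)) (i : Fin s) (j : Fin m) :
    freeAugmentation K m (q i j) = 0 := by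
  have h := coeff_zero_coaction (FreeAlgebra.adjoin_range_ι K (Fin m)) freeCoaction_ι
    (freeAugmentation_ι (K := K) (m := m)) (q i j)
  rw [coaction_of_mem_wordSpan freeCoaction_ι (hq i j), coeff_monomial,
    if_neg (by have := hr.two_le i; omega)] at h
  exact (map_eq_zero_iff _ (FreeAlgebra.algebraMap_leftInverse (R := K)
    (X := Fin m)).injective).1 h.symm

theorem presentedMk_mem_wordSpan {p : ℕ} {a : FreeAlgebra K (Fin m)}
    (ha : a ∈ wordSpan K (FreeAlgebra.ι K) p) : presentedMk r a ∈ wordSpan K (gen r) p := by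
  have h : wordSpan K (gen r) p =
      (wordSpan K (FreeAlgebra.ι K) p).map (presentedMk r).toLinearMap := by
    rw [wordSpan, wordSpan, Submodule.map_pow, Submodule.map_span, ← Set.range_comp]
    rfl
  rw [h]
  exact ⟨a, ha, rfl⟩

/-- A regular algebra of dimension two has a single relation. -/
theorem IsASRegular.card_relations_eq_one (hr : IsHomogeneousPresentation r d)
    (hreg : IsASRegular r 2) : s = 1 := by
  obtain ⟨q, hq1, hq⟩ := hr.exists_left_coefficients
  obtain ⟨ε, hε, hε_gen⟩ := hr.exists_augmentation
  obtain ⟨Λ, h1, h2, h3⟩ := exists_addMonoidHom_of_ext_two hq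
    (hr.relationMap_injective hq hreg.projective_ker_generatorMap) hreg.ext_eq
  -- The kernel of Λ is the image of a matrix whose entries have zero augmentation.
  have h4 : ∀ v, Λ v = 0 → ∀ i, ε (v i) = 0 := fun v hv i => by
    obtain ⟨w, hw⟩ := (h3 v).1 hv
    rw [hw, map_sum]
    exact Finset.sum_eq_zero fun j _ => by
      rw [map_mul, hε, hr.augmentation_leftCoeff hq1, zero_mul]
  rcases Nat.lt_trichotomy s 1 with hs | hs | hs
  · obtain rfl : s = 0 := by omega
    obtain ⟨v, hv⟩ := h2 1
    rw [Subsingleton.elim v 0, map_zero] at hv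
    exact absurd hv zero_ne_one
  · exact hs
  · exfalso
    let i : Fin s := ⟨0, by omega⟩
    let i' : Fin s := ⟨1, hs⟩
    have hii : i ≠ i' := by simp [i, i']
    have h5 : ∀ k : Fin s, Λ (Pi.single k 1) ≠ 0 := fun k hk => by
      simpa using h4 _ hk k
    -- The combination Λ(e_{i'}) e_i - Λ(e_i) e_{i'} is killed by Λ, yet its i-th augmentation is
    -- Λ(e_{i'}) ≠ 0.
    have h6 := h4 ((fun k => algebraMap K (Presented r) (Λ (Pi.single i' 1)) *
        (Pi.single i 1 : Fin s → Presented r) k) -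
      fun k => algebraMap K (Presented r) (Λ (Pi.single i 1)) *
        (Pi.single i' 1 : Fin s → Presented r) k)
      (by rw [map_sub, h1, h1, mul_comm, sub_self]) i
    simp [hii, h5] at h6

end Regular

/-! ### One relation: quadratic and nondegenerate -/

section SingleRelation

variable {K : Type u} [Field K] {m : ℕ} {r : Fin 1 → FreeAlgebra K (Fin m)} {d : Fin 1 → ℕ}

/-- Without generators the relation would be zero, against minimality. -/
theorem IsHomogeneousPresentation.generators_nonempty (hr : IsHomogeneousPresentation r d) :
    0 < m := by
  obtain ⟨q, hq1, hq⟩ := hr.exists_left_coefficients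
  rcases Nat.eq_zero_or_pos m with rfl | hm
  · refine absurd ?_ (hr.minimal 0)
    rw [hq 0, Finset.univ_eq_empty, Finset.sum_empty]
    exact TwoSidedIdeal.zero_mem _
  · exact hm

theorem IsHomogeneousPresentation.gen_ne_zero (hr : IsHomogeneousPresentation r d) (k : Fin m) :
    gen r k ≠ 0 :=
  hr.linearIndependent_gen.ne_zero k

/-- In a regular algebra of dimension two the relation is a nondegenerate quadratic form. -/
theorem IsASRegular.exists_nondegenerate_matrix (hr : IsHomogeneousPresentation r d)
    (hreg : IsASRegular r 2) : d 0 = 2 ∧ ∃ C : Matrix (Fin m) (Fin m) K, IsUnit C ∧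
      ∀ i, r i = ∑ j, (∑ k, C j k • FreeAlgebra.ι K k) * FreeAlgebra.ι K j := by
  obtain ⟨q, hq1, hq⟩ := hr.exists_left_coefficients
  obtain ⟨ε, hε, hε_gen⟩ := hr.exists_augmentation
  obtain ⟨ρ, hρ⟩ := hr.exists_coaction
  obtain ⟨Λ, h1, h2, h3⟩ := exists_addMonoidHom_of_ext_two hq
    (hr.relationMap_injective hq hreg.projective_ker_generatorMap) hreg.ext_eq
  have h4 : ∀ v, Λ v = 0 → ∀ i, ε (v i) = 0 := fun v hv i => by
    obtain ⟨w, hw⟩ := (h3 v).1 hv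
    rw [hw, map_sum]
    exact Finset.sum_eq_zero fun j _ => by
      rw [map_mul, hε, hr.augmentation_leftCoeff hq1, zero_mul]
  have h5 : Λ 1 ≠ 0 := fun h => by simpa using h4 _ h 0
  -- Subtracting the scalar Λ(v)/Λ(1) puts v in the kernel of Λ, so this scalar equals ε(v): Λ is
  -- proportional to ε.
  have h6 : ∀ v, ε (v 0) = 0 → Λ v = 0 := fun v hv => by
    have h7 := h4 (v - fun i => algebraMap K (Presented r) (Λ v / Λ 1) *
        (1 : Fin 1 → Presented r) i)
      (by rw [map_sub, h1, div_mul_cancel₀ _ h5, sub_self]) 0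
    simpa [hv, h5] using h7
  have h7 : ∀ k, ∃ w : Fin m → Presented r, gen r k = ∑ j, presentedMk r (q 0 j) * w j := by
    intro k
    obtain ⟨w, hw⟩ := (h3 fun _ => gen r k).1 (h6 _ (hε_gen k))
    exact ⟨w, hw 0⟩
  choose w hw using h7
  -- Each generator is in the right ideal of the q_0j, which are homogeneous of degree d - 1. The
  -- degree one component leaves room for this only if d - 1 ≤ 1.
  have h8 : ∀ k, gen r k = ∑ j, (monomial (d 0 - 1) (presentedMk r (q 0 j)) *
      ρ (w k j)).coeff 1 := fun k => by
    have h := congrArg (fun a => (ρ a).coeff 1) (hw k)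
    simpa [hρ, coaction_of_mem_wordSpan hρ (presentedMk_mem_wordSpan (hq1 _ _))] using h
  have hd : d 0 = 2 := by
    by_contra hne
    have h2 := hr.two_le 0
    refine hr.gen_ne_zero ⟨0, hr.generators_nonempty⟩ ?_
    rw [h8]
    refine Finset.sum_eq_zero fun j _ => ?_
    rw [coeff_mul]
    refine Finset.sum_eq_zero fun p hp => ?_
    have := Finset.HasAntidiagonal.mem_antidiagonal.1 hp
    rw [coeff_monomial, if_neg (by omega), zero_mul]
  refine ⟨hd, ?_⟩
  have h9 : ∀ j, ∃ c : Fin m → K, q 0 j = ∑ k, c k • FreeAlgebra.ι K k := fun j => by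
    have h := hq1 0 j
    rw [hd, wordSpan, pow_one] at h
    obtain ⟨c, hc⟩ := (Submodule.mem_span_range_iff_exists_fun K).1 h
    exact ⟨c, hc.symm⟩
  choose C hC using h9
  refine ⟨Matrix.of C, ?_, fun i => ?_⟩
  -- With d = 2 only the constant terms of the w_kj count in degree one; their matrix is a left
  -- inverse of C, by independence of the generators.
  · let W : Matrix (Fin m) (Fin m) K := Matrix.of fun k j => ε (w k j)
    refine IsUnit.of_mul_eq_one_right W ?_
    ext k l
    have h10 : gen r k = ∑ j, ε (w k j) • presentedMk r (q 0 j) := by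
      conv_lhs => rw [h8]
      refine Finset.sum_congr rfl fun j _ => ?_
      have h := coeff_monomial_mul (ρ (w k j)) 1 0 (presentedMk r (q 0 j))
      rw [hd]
      rw [zero_add] at h
      rw [h, coeff_zero_coaction (adjoin_gen r) hρ hε_gen, Algebra.smul_def, Algebra.commutes]
    have h11 := Fintype.linearIndependent_iff.1 hr.linearIndependent_gen
      (fun l => ∑ j, ε (w k j) * C j l - if k = l then 1 else 0) (by
        simp only [sub_smul, Finset.sum_sub_distrib, ite_smul, one_smul, zero_smul,
          Finset.sum_ite_eq, Finset.mem_univ, if_true]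
        rw [sub_eq_zero]
        conv_rhs => rw [h10]
        simp only [hC, map_sum, map_smul, presentedMk_ι, Finset.sum_smul, Finset.smul_sum,
          smul_smul]
        exact Finset.sum_comm)
    rw [Matrix.mul_apply, Matrix.one_apply]
    exact sub_eq_zero.1 (h11 l)
  · obtain rfl := Subsingleton.elim i 0
    rw [hq 0]
    simp [hC]

end SingleRelation

end SkewPBW

namespace SkewPBW

open Polynomial

/-! ### Growth and the number of generators -/

section Growth

variable {K : Type u} [Field K] {m : ℕ}

instance finite_wordSpan {S : Type v} [Ring S] [Algebra K S] (t : Fin m → S) (p : ℕ) :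
    Module.Finite K (wordSpan K t p) :=
  Module.Finite.iff_fg.2 (Submodule.FG.pow (Submodule.fg_span (Set.finite_range t)) p)

instance finite_wordSpanLE {S : Type v} [Ring S] [Algebra K S] (t : Fin m → S) (p : ℕ) :
    Module.Finite K (wordSpanLE K t p) :=
  Module.Finite.iff_fg.2
    (Submodule.FG.pow (Submodule.fg_span ((Set.finite_range t).insert 1)) p)

theorem wordSpan_le_wordSpanLE {S : Type v} [Ring S] [Algebra K S] (t : Fin m → S) (p : ℕ) :
    wordSpan K t p ≤ wordSpanLE K t p :=
  pow_le_pow_left' (Submodule.span_mono (Set.subset_insert _ _)) p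

variable {r : Fin 1 → FreeAlgebra K (Fin m)} {d : Fin 1 → ℕ}

/-- The Golod–Shafarevich inequality for a single quadratic relation. -/
theorem finrank_wordSpan_of_syzygies {S : Type v} [Ring S] [Algebra K S] {t : Fin m → S}
    (ht : Algebra.adjoin K (Set.range t) = ⊤) {ρ : S →ₐ[K] S[X]}
    (hρ : ∀ i, ρ (t i) = monomial 1 (t i)) {z : Fin m → S} (hz : ∀ j, z j ∈ wordSpan K t 1)
    (hsyz : ∀ a : Fin m → S, ∑ j, a j * t j = 0 → ∃ b, ∀ j, a j = b * z j) (n : ℕ) :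
    m * Module.finrank K (wordSpan K t (n + 1)) ≤
      Module.finrank K (wordSpan K t (n + 1 + 1)) + Module.finrank K (wordSpan K t n) := by
  let Φ : (Fin m → wordSpan K t (n + 1)) →ₗ[K] S :=
    ∑ j, LinearMap.mulRight K (t j) ∘ₗ (wordSpan K t (n + 1)).subtype ∘ₗ LinearMap.proj j
  have hΦ : ∀ v, Φ v = ∑ j, (v j : S) * t j := fun v => by simp [Φ]
  let Ψ : wordSpan K t n →ₗ[K] (Fin m → wordSpan K t (n + 1)) :=
    LinearMap.pi fun j => (LinearMap.mulRight K (z j)).restrict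
      fun a ha => mul_mem_wordSpan ha (hz j)
  have h1 : LinearMap.range Φ ≤ wordSpan K t (n + 1 + 1) := by
    rintro _ ⟨v, rfl⟩
    rw [hΦ]
    exact sum_mem fun j _ => mul_mem_wordSpan (v j).2 (generator_mem_wordSpan_one j)
  -- A homogeneous syzygy is b z for some b; replacing b by its degree n component keeps the
  -- identity, since z has degree 1.
  have h2 : LinearMap.ker Φ ≤ LinearMap.range Ψ := by
    intro v hv
    rw [LinearMap.mem_ker, hΦ] at hv
    obtain ⟨b, hb⟩ := hsyz _ hv
    refine ⟨⟨(ρ b).coeff n, coeff_coaction_mem_wordSpan ht hρ _ _⟩, ?_⟩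
    ext j
    have h3 := congrArg (fun a => (ρ a).coeff (n + 1)) (hb j)
    simp only [map_mul, coaction_of_mem_wordSpan hρ (v j).2, coaction_of_mem_wordSpan hρ (hz j),
      coeff_monomial_same, coeff_mul_monomial] at h3
    exact h3.symm
  have h3 := LinearMap.finrank_range_add_finrank_ker Φ
  rw [Module.finrank_pi_fintype] at h3
  simp only [Finset.sum_const, Finset.card_univ, Fintype.card_fin, smul_eq_mul] at h3
  rw [← h3]
  exact add_le_add (Submodule.finrank_mono h1)
    ((Submodule.finrank_mono h2).trans (LinearMap.finrank_range_le Ψ))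

theorem IsHomogeneousPresentation.finrank_wordSpan (hr : IsHomogeneousPresentation r d)
    (hd : d 0 = 2) (n : ℕ) :
    m * Module.finrank K (wordSpan K (gen r) (n + 1)) ≤
      Module.finrank K (wordSpan K (gen r) (n + 1 + 1)) +
        Module.finrank K (wordSpan K (gen r) n) := by
  obtain ⟨q, hq1, hq⟩ := hr.exists_left_coefficients
  obtain ⟨ρ, hρ⟩ := hr.exists_coaction
  refine finrank_wordSpan_of_syzygies (adjoin_gen r) hρ (z := fun j => presentedMk r (q 0 j))
    (fun j => ?_) (fun a ha => ?_) n
  · have := hq1 0 j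
    rw [hd] at this
    exact presentedMk_mem_wordSpan this
  · obtain ⟨b, hb⟩ := exists_of_sum_mul_gen_eq_zero hq ha
    exact ⟨b 0, fun j => by rw [hb, Fin.sum_univ_one]⟩

theorem IsHomogeneousPresentation.two_pow_le_finrank (hr : IsHomogeneousPresentation r d)
    (hd : d 0 = 2) (hm : 3 ≤ m) (n : ℕ) :
    2 ^ n ≤ Module.finrank K (wordSpan K (gen r) n) := by
  have : Nontrivial (Presented r) :=
    nontrivial_of_ne _ _ (hr.gen_ne_zero ⟨0, hr.generators_nonempty⟩)
  have h0 : Module.finrank K (wordSpan K (gen r) 0) = 1 := by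
    rw [wordSpan, pow_zero, Submodule.one_eq_span]
    exact finrank_span_singleton one_ne_zero
  have h1 : Module.finrank K (wordSpan K (gen r) 1) = m := by
    rw [wordSpan, pow_one, finrank_span_eq_card hr.linearIndependent_gen, Fintype.card_fin]
  -- By induction, with a_n the dimensions: a_{n+2} ≥ 3 a_{n+1} - a_n ≥ 2 a_{n+1}, since a_n ≤
  -- a_{n+1}.
  have h2 : ∀ n, 2 * Module.finrank K (wordSpan K (gen r) n) ≤
      Module.finrank K (wordSpan K (gen r) (n + 1)) := by
    intro n
    induction n with
    | zero => rw [h0, h1]; omega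
    | succ n ih =>
      have h3 := hr.finrank_wordSpan hd n
      have h4 := Nat.mul_le_mul_right (Module.finrank K (wordSpan K (gen r) (n + 1))) hm
      omega
  induction n with
  | zero => rw [h0, pow_zero]
  | succ n ih =>
    have := h2 n
    rw [pow_succ]
    omega

/-- For dimensions at least 2^n, the logarithm to base n is at least n log 2 / log n, which tends to
infinity. -/
theorem gkDim_eq_top_of_two_pow_le {s : ℕ} {r : Fin s → FreeAlgebra K (Fin m)}
    (h : ∀ n, 2 ^ n ≤ Module.finrank K (wordSpan K (gen r) n)) : gkDim r = ⊤ := by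
  have h1 : ∀ n : ℕ, 2 ≤ n → (n : ℝ) * Real.log 2 / Real.log n ≤
      Real.logb n (Module.finrank K (wordSpanLE K (gen r) n)) := fun n hn => by
    have h2 : (2 : ℝ) ^ n ≤ Module.finrank K (wordSpanLE K (gen r) n) := by
      exact_mod_cast (h n).trans (Submodule.finrank_mono (wordSpan_le_wordSpanLE _ n))
    rw [Real.logb, ← Real.log_pow]
    have h3 : (1 : ℝ) < n := by exact_mod_cast hn
    have := Real.log_pos h3
    gcongr
  have h2 : Filter.Tendsto (fun n : ℕ => (n : ℝ) * Real.log 2 / Real.log n) Filter.atTop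
      Filter.atTop := by
    have h3 : Filter.Tendsto (fun x : ℝ => x / Real.log x) Filter.atTop Filter.atTop := by
      have h4 : Filter.Tendsto (fun x : ℝ => Real.log x / x) Filter.atTop
          (nhdsWithin 0 (Set.Ioi 0)) := by
        refine tendsto_nhdsWithin_iff.2 ⟨Real.isLittleO_log_id_atTop.tendsto_div_nhds_zero, ?_⟩
        filter_upwards [Filter.eventually_gt_atTop (1 : ℝ)] with x hx
        exact div_pos (Real.log_pos hx) (by linarith)
      refine h4.inv_tendsto_nhdsGT_zero.congr fun x => ?_
      simp
    have h5 := (h3.comp tendsto_natCast_atTop_atTop).atTop_mul_const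
      (Real.log_pos one_lt_two)
    refine h5.congr fun n => ?_
    simp only [Function.comp]
    ring
  have h3 : Filter.Tendsto (fun n : ℕ =>
      ((Real.logb n (Module.finrank K (wordSpanLE K (gen r) n)) : ℝ) : EReal)) Filter.atTop
      (nhds ⊤) :=
    EReal.tendsto_coe_nhds_top_iff.2 (Filter.tendsto_atTop_mono' _
      ((Filter.eventually_ge_atTop 2).mono h1) h2)
  exact h3.limsup_eq

/-- A regular algebra of dimension two has two generators. -/
theorem IsASRegular.card_generators_eq_two (hr : IsHomogeneousPresentation r d)
    (hreg : IsASRegular r 2) : m = 2 := by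
  obtain ⟨hd, -⟩ := hreg.exists_nondegenerate_matrix hr
  have h0 := hr.generators_nonempty
  rcases Nat.lt_trichotomy m 2 with hm | hm | hm
  · exfalso
    obtain rfl : m = 1 := by omega
    obtain ⟨q, hq1, hq⟩ := hr.exists_left_coefficients
    obtain ⟨c, hc⟩ : ∃ c : K, c • FreeAlgebra.ι K 0 = q 0 0 := by
      have h := hq1 0 0
      rw [hd, wordSpan, pow_one, Set.range_unique] at h
      exact Submodule.mem_span_singleton.1 h
    have hinj := hr.relationMap_injective hq hreg.projective_ker_generatorMap
    -- Here r = c t² and q = c t, so t · (c t) = 0 makes t a nonzero element of the kernel.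
    have h1 : relationMap hq (fun _ => gen r 0) = 0 := by
      refine Subtype.ext (funext fun j => ?_)
      obtain rfl := Subsingleton.elim j 0
      have h2 := presentedMk_relation r 0
      rw [hq 0] at h2
      rw [coe_relationMap]
      simpa [← hc] using h2
    have h2 := congrFun ((injective_iff_map_eq_zero _).1 hinj _ h1) 0
    exact hr.gen_ne_zero 0 h2
  · exact hm
  · exact absurd (gkDim_eq_top_of_two_pow_le (hr.two_pow_le_finrank hd hm)) hreg.gkdim.ne

end Growth

end SkewPBW

namespace SkewPBW

open Polynomial

/-! ### Skew derivations of K[y] and the Ore extension as a module -/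

section Derivation

variable {K : Type u} [Field K]

/-- The substitution `y ↦ f` on `K[y]`, together with the skew derivation sending `y` to `g`,
as the upper row of a representation by triangular matrices. -/
noncomputable def skewRep (f g : K[X]) : K[X] →ₐ[K] Matrix (Fin 2) (Fin 2) K[X] :=
  aeval !![f, g; 0, X]

/-- The matrices stay upper triangular with diagonal (σ(p), p); multiplying two of them, the corner
entry obeys the skew Leibniz rule. -/
theorem skewRep_apply (f g p : K[X]) :
    skewRep f g p = !![aeval f p, skewRep f g p 0 1; 0, p] := by
  induction p using Polynomial.induction_on' with
  | add p q hp hq =>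
    rw [map_add, hp, hq]
    ext i j
    fin_cases i <;> fin_cases j <;> simp
  | monomial n a =>
    induction n with
    | zero =>
      have : skewRep f g (monomial 0 a) = algebraMap K _ a := (skewRep f g).commutes a
      rw [this]
      ext i j
      fin_cases i <;> fin_cases j <;>
        simp [Matrix.algebraMap_matrix_apply]
    | succ n ih =>
      have h : (monomial (n + 1) a : K[X]) = monomial n a * X := by simp
      have hX : skewRep f g X = !![f, g; 0, X] := aeval_X _
      rw [h, map_mul, ih, hX, map_mul]
      ext i j
      fin_cases i <;> fin_cases j <;> simp

/-- The `σ`-derivation of `K[y]` with `y ↦ g`, where `σ` is the substitution `y ↦ f`. -/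
noncomputable def skewDerivation (f g : K[X]) : K[X] →ₗ[K] K[X] where
  toFun p := skewRep f g p 0 1
  map_add' p q := by simp
  map_smul' c p := by simp

theorem skewDerivation_mul (f g p q : K[X]) :
    skewDerivation f g (p * q) = aeval f p * skewDerivation f g q + skewDerivation f g p * q := by
  change skewRep f g (p * q) 0 1 = _
  rw [map_mul, skewRep_apply f g p, skewRep_apply f g q]
  simp [skewDerivation]

@[simp] theorem skewDerivation_X (f g : K[X]) : skewDerivation f g X = g := by
  simp [skewDerivation, skewRep]

@[simp] theorem skewDerivation_one (f g : K[X]) : skewDerivation f g 1 = 0 := by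
  simp [skewDerivation]

theorem aeval_mem_degreeLE {f : K[X]} (hf : f.natDegree ≤ 1) {n : ℕ} {p : K[X]}
    (hp : p ∈ degreeLE K n) : aeval f p ∈ degreeLE K n := by
  rw [mem_degreeLE] at *
  change (p.comp f).degree ≤ _
  refine natDegree_le_iff_degree_le.1 (natDegree_comp_le.trans ?_)
  have := natDegree_le_iff_degree_le.2 hp
  nlinarith

theorem skewDerivation_mem_degreeLE {f g : K[X]} (hf : f.natDegree ≤ 1) (hg : g.natDegree ≤ 2)
    {n : ℕ} {p : K[X]} (hp : p ∈ degreeLE K n) :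
    skewDerivation f g p ∈ degreeLE K ((n + 1 : ℕ) : WithBot ℕ) := by
  have hpow : ∀ n : ℕ, skewDerivation f g (X ^ n) ∈ degreeLE K ((n + 1 : ℕ) : WithBot ℕ) := by
    intro n
    induction n with
    | zero => rw [pow_zero, skewDerivation_one]; exact zero_mem _
    | succ n ih =>
      rw [pow_succ, skewDerivation_mul, skewDerivation_X]
      refine add_mem ?_ ?_
      · have h1 : aeval f (X ^ n : K[X]) ∈ degreeLE K n :=
          aeval_mem_degreeLE hf (mem_degreeLE.2 (degree_X_pow_le n))
        rw [mem_degreeLE, ← natDegree_le_iff_degree_le] at *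
        exact natDegree_mul_le.trans (by omega)
      · rw [mem_degreeLE, ← natDegree_le_iff_degree_le] at *
        exact natDegree_mul_le.trans (by rw [natDegree_X]; omega)
  rw [p.as_sum_range_C_mul_X_pow, map_sum]
  refine sum_mem fun k hk => ?_
  rw [← smul_eq_C_mul, map_smul]
  refine Submodule.smul_mem _ _ (degreeLE_mono ?_ (hpow k))
  have h1 := natDegree_le_iff_degree_le.2 (mem_degreeLE.1 hp)
  have h2 := Finset.mem_range.1 hk
  exact_mod_cast (show k + 1 ≤ n + 1 by omega)

/-- The substitution y ↦ q⁻¹(y - c) is a left inverse. -/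
theorem aeval_linear_injective {q c : K} (hq : q ≠ 0) :
    Function.Injective (aeval (C q * X + C c : K[X]) : K[X] →ₐ[K] K[X]) := by
  have h : ((aeval (C q⁻¹ * (X - C c)) : K[X] →ₐ[K] K[X]).comp
      (aeval (C q * X + C c))) = AlgHom.id K _ := by
    ext1
    simp only [AlgHom.comp_apply, aeval_X, map_add, map_mul, AlgHom.id_apply]
    rw [show ∀ a : K, (aeval (C q⁻¹ * (X - C c)) : K[X] →ₐ[K] K[X]) (C a) = C a from
      fun a => aeval_C _ a, show ∀ a : K, (aeval (C q⁻¹ * (X - C c)) : K[X] →ₐ[K] K[X]) (C a) = C a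
      from fun a => aeval_C _ a, ← mul_assoc, ← C_mul, mul_inv_cancel₀ hq]
    simp
  exact Function.LeftInverse.injective (AlgHom.congr_fun h)

/-- The operator of left multiplication by `x` on the Ore extension `K[y][x; σ, δ]`, whose elements
are written as sequences of coefficients. -/
noncomputable def oreOperator (f g : K[X]) : Module.End K (ℕ → K[X]) where
  toFun v n := skewDerivation f g (v n) + Nat.casesOn n 0 fun k => aeval f (v k)
  map_add' v w := by
    ext1 n
    cases n
    · simp
    · simp only [Pi.add_apply, map_add]
      abel
  map_smul' c v := by
    ext1 n
    cases n <;> simp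

theorem oreOperator_zero (f g : K[X]) (v : ℕ → K[X]) :
    oreOperator f g v 0 = skewDerivation f g (v 0) := add_zero _

theorem oreOperator_succ (f g : K[X]) (v : ℕ → K[X]) (n : ℕ) :
    oreOperator f g v (n + 1) = skewDerivation f g (v (n + 1)) + aeval f (v n) := rfl

theorem oreOperator_mul (f g p : K[X]) (v : ℕ → K[X]) :
    oreOperator f g (p • v) =
      aeval f p • oreOperator f g v + skewDerivation f g p • v := by
  ext1 n
  cases n with
  | zero => simp [oreOperator_zero, skewDerivation_mul]
  | succ n =>
    simp only [oreOperator_succ, Pi.add_apply, Pi.smul_apply, smul_eq_mul, skewDerivation_mul,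
      map_mul]
    ring

/-- The derivation kills constants, so x^n applied to 1 is the n-th basis sequence. This is what
will separate the powers of x. -/
theorem oreOperator_pow_apply (f g : K[X]) (n : ℕ) :
    (oreOperator f g ^ n) (Pi.single 0 1) = Pi.single n 1 := by
  induction n with
  | zero => rfl
  | succ n ih =>
    rw [pow_succ', Module.End.mul_apply, ih]
    ext1 k
    cases k with
    | zero =>
      rw [oreOperator_zero, Pi.single_apply]
      split_ifs <;> simp
    | succ k =>
      rw [oreOperator_succ, Pi.single_apply, Pi.single_apply]
      by_cases h : k = n
      · simp [h]
      · simp only [Pi.single_apply, h, if_false, map_zero, add_zero, Nat.add_right_cancel_iff]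
        split_ifs <;> simp

end Derivation

/-! ### From the commutation rule to a filtered skew PBW extension -/

section Ore

variable {K : Type u} [Field K] {U : Type v} [Ring U] [Algebra K U] {f g : K[X]} {x y : U}

theorem mul_aeval_eq (hxy : x * y = aeval y f * x + aeval y g) (p : K[X]) :
    x * aeval y p = aeval y (aeval f p) * x + aeval y (skewDerivation f g p) := by
  induction p using Polynomial.induction_on' with
  | add p q hp hq =>
    simp only [map_add, mul_add, add_mul, hp, hq]
    abel
  | monomial n a =>
    induction n with
    | zero =>
      have h1 : (monomial 0 a : K[X]) = algebraMap K _ a := rfl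
      have h2 : skewDerivation f g (algebraMap K K[X] a) = 0 := by
        rw [Algebra.algebraMap_eq_smul_one, map_smul, skewDerivation_one, smul_zero]
      rw [h1, h2, map_zero, add_zero, AlgHom.commutes, AlgHom.commutes, AlgHom.commutes,
        Algebra.commutes]
    | succ n ih =>
      have h : (monomial (n + 1) a : K[X]) = monomial n a * X := by simp
      rw [h, skewDerivation_mul, map_mul, ← mul_assoc, ih, add_mul, mul_assoc, aeval_X, hxy]
      simp only [map_mul, map_add, aeval_X, skewDerivation_X, mul_add, mul_assoc]
      abel

/-- An algebra generated by `x` and `y` with `x y = σ(y) x + δ(y)` that acts on the Ore extension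
`K[y][x; σ, δ]` is a `σ`-filtered skew PBW extension of `K[y]`. -/
theorem exists_isSigmaFiltered_of_ore {q c : K} (hq : q ≠ 0) (hf : f = C q * X + C c)
    (hg : g.natDegree ≤ 2) (hxy : x * y = aeval y f * x + aeval y g)
    (hgen : Algebra.adjoin K {x, y} = ⊤) (Θ : U →ₐ[K] Module.End K (ℕ → K[X]))
    (hx : Θ x = oreOperator f g) (hy : Θ y = Algebra.lsmul K K (ℕ → K[X]) (X : K[X])) :
    ∃ (R : Subalgebra K U) (F : PosFiltration K R) (n : ℕ) (x : Fin n → U),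
      1 ≤ n ∧ IsSigmaFiltered R F x ∧ (IsTrivialBase R F ∨ IsPolynomialBase R F) := by
  have hΘ : ∀ p : K[X], Θ (aeval y p) = Algebra.lsmul K K (ℕ → K[X]) p := fun p => by
    rw [← aeval_algHom_apply, hy, aeval_algHom_apply, aeval_X_left_apply]
  -- Acting on 1 recovers the coefficient p of p(y) x^k, which gives both the injectivity of K[y] →
  -- U and the independence of the powers of x.
  have hΘ2 : ∀ (p : K[X]) (k : ℕ), Θ (aeval y p * x ^ k) (Pi.single 0 1) = Pi.single k p :=
    fun p k => by
      rw [map_mul, map_pow, hx, hΘ, Module.End.mul_apply, oreOperator_pow_apply]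
      change p • (Pi.single k 1 : ℕ → K[X]) = _
      rw [← Pi.single_smul, smul_eq_mul, mul_one]
  have hinj : Function.Injective (aeval y : K[X] →ₐ[K] U) := by
    refine (injective_iff_map_eq_zero _).2 fun p hp => ?_
    have := congrFun (hΘ2 p 0) 0
    rw [hp] at this
    simpa using this.symm
  have hfdeg : f.natDegree ≤ 1 := by
    rw [hf]
    exact natDegree_linear_le
  have hfinj : Function.Injective (aeval f : K[X] →ₐ[K] K[X]) := by
    rw [hf]
    exact aeval_linear_injective hq
  let R : Subalgebra K U := (aeval y : K[X] →ₐ[K] U).range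
  let e : K[X] ≃ₐ[K] R := AlgEquiv.ofInjective _ hinj
  have he : ∀ p, (e p : U) = aeval y p := fun p => rfl
  have hmem : ∀ p, aeval y p ∈ R := fun p => ⟨p, rfl⟩
  let F : PosFiltration K R :=
    { piece p := (degreeLE K (p : WithBot ℕ)).map e.toLinearMap
      mono p := Submodule.map_mono (degreeLE_mono (by exact_mod_cast Nat.le_succ p))
      one_mem := ⟨1, mem_degreeLE.2 degree_one_le, map_one e⟩
      mul_mem := by
        rintro p q _ _ ⟨a, ha, rfl⟩ ⟨b, hb, rfl⟩
        refine ⟨a * b, ?_, map_mul e a b⟩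
        rw [SetLike.mem_coe, mem_degreeLE, ← natDegree_le_iff_degree_le] at *
        exact natDegree_mul_le.trans (add_le_add ha hb)
      exhaust a := ⟨(e.symm a).natDegree, e.symm a, mem_degreeLE.2 degree_le_natDegree,
        e.apply_symm_apply a⟩ }
  let σ : R →ₐ[K] R := (e : K[X] →ₐ[K] R).comp ((aeval f).comp (e.symm : R →ₐ[K] K[X]))
  let δ : R →ₗ[K] R := e.toLinearMap ∘ₗ skewDerivation f g ∘ₗ e.symm.toLinearMap
  have hσe : ∀ p, σ (e p) = e (aeval f p) := fun p => by simp [σ]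
  have hδe : ∀ p, δ (e p) = e (skewDerivation f g p) := fun p => by simp [δ]
  have hσinj : Function.Injective σ := e.injective.comp (hfinj.comp e.symm.injective)
  have hcomm : ∀ a : R, x * a = σ a * x + δ a := fun a => by
    obtain ⟨p, rfl⟩ := e.surjective a
    rw [hσe, hδe, he, he, he]
    exact mul_aeval_eq hxy p
  let X' : Fin 1 → U := fun _ => x
  have hmon : ∀ α, mon X' α = x ^ α 0 := fun α => by simp [mon, X']
  have hlin : LinearIndependent R (mon X') := by
    rw [linearIndependent_iff']
    intro S w hw α hα
    have hw2 : ∀ α, w α • mon X' α = aeval y (e.symm (w α)) * x ^ α 0 := fun α => by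
      rw [Subalgebra.smul_def, hmon, smul_eq_mul, ← he, e.apply_symm_apply]
    have h1 := congrArg (fun u => Θ u (Pi.single 0 1) (α 0)) hw
    simp only [hw2, map_sum, LinearMap.sum_apply, hΘ2, Finset.sum_apply, map_zero,
      LinearMap.zero_apply, Pi.zero_apply] at h1
    rw [Finset.sum_eq_single α] at h1
    · simpa using h1
    · intro β _ hβ
      rw [Pi.single_apply, if_neg]
      intro h
      exact hβ (funext fun i => by rw [Subsingleton.elim i 0]; exact h.symm)
    · exact fun h => absurd hα h
  let M : Submodule R U := Submodule.span R (Set.range (mon X'))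
  have hM : ∀ k, x ^ k ∈ M := fun k => Submodule.subset_span ⟨fun _ => k, hmon _⟩
  have hxM : ∀ u ∈ M, x * u ∈ M := fun u hu => by
    induction hu using Submodule.span_induction with
    | mem u hu =>
      obtain ⟨α, rfl⟩ := hu
      rw [hmon, ← pow_succ']
      exact hM _
    | zero => rw [mul_zero]; exact zero_mem _
    | add u v _ _ hu hv => rw [mul_add]; exact add_mem hu hv
    | smul a u hu' hu =>
      rw [Subalgebra.smul_def, smul_eq_mul, ← mul_assoc, hcomm, add_mul, mul_assoc]
      exact add_mem (M.smul_mem (σ a) hu) (M.smul_mem (δ a) hu')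
  have hspan : ⊤ ≤ M := by
    rintro u -
    have hu : u ∈ Algebra.adjoin K {x, y} := by rw [hgen]; trivial
    -- The span of the powers of x contains 1, so it suffices that it be stable under left
    -- multiplication by the generators.
    suffices h : ∀ w ∈ M, u * w ∈ M by simpa using h 1 (by simpa using hM 0)
    induction hu using Algebra.adjoin_induction with
    | mem u hu =>
      rcases hu with rfl | rfl
      · exact hxM
      · exact fun w hw => M.smul_mem (⟨u, by simpa using hmem X⟩ : R) hw
    | algebraMap a => exact fun w hw => M.smul_mem (algebraMap K R a) hw
    | add u v _ _ hu hv =>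
      intro w hw
      rw [add_mul]
      exact add_mem (hu w hw) (hv w hw)
    | mul u v _ _ hu hv =>
      intro w hw
      rw [mul_assoc]
      exact hu _ (hv _ hw)
  have : Nontrivial R := e.symm.toEquiv.nontrivial
  have hskew : IsSkewPBWExtension R X' :=
    { linearIndependent := hlin
      span_eq_top := hspan
      comm_coeff := fun i a ha => ⟨σ a, (map_ne_zero_iff σ hσinj).2 ha, by
        change x * a - σ a * x ∈ R
        rw [hcomm, add_sub_cancel_left]
        exact (δ a).2⟩
      comm_var := fun i j => ⟨1, one_ne_zero, by
        simp only [X', OneMemClass.coe_one, one_mul, sub_self]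
        exact zero_mem _⟩ }
  refine ⟨R, F, 1, X', le_rfl, ⟨hskew, ⟨fun _ => σ, fun _ => δ, fun _ => hσinj, fun _ a b => ?_,
    fun _ a => hcomm a, fun _ p => ?_, fun _ p => ?_⟩, fun i j => ?_⟩, Or.inr ⟨e, fun p => rfl⟩⟩
  · obtain ⟨a, rfl⟩ := e.surjective a
    obtain ⟨b, rfl⟩ := e.surjective b
    rw [← map_mul, hδe, hδe, hδe, hσe, skewDerivation_mul, map_add, map_mul, map_mul]
  · rintro _ ⟨a, ha, rfl⟩
    exact ⟨aeval f a, aeval_mem_degreeLE hfdeg ha, (hσe a).symm⟩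
  · rintro _ ⟨a, ha, rfl⟩
    exact ⟨skewDerivation f g a, skewDerivation_mem_degreeLE hfdeg hg ha, (hδe a).symm⟩
  -- With one variable the only product is x², a basis monomial with coefficient 1 of degree 0.
  · have h1 : X' j * X' i = hskew.basis fun _ => 2 := by
      rw [IsSkewPBWExtension.basis, Module.Basis.mk_apply, hmon, pow_two]
    have h2 : F.deg 1 = 0 := Nat.sInf_eq_zero.2 (Or.inl F.one_mem)
    rw [IsSkewPBWExtension.tdeg, h1, Module.Basis.repr_self,
      Finsupp.support_single _ one_ne_zero, Finset.sup_singleton, Finsupp.single_eq_same,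
      h2]
    simp

end Ore

end SkewPBW

namespace SkewPBW

open Polynomial

/-! ### Isotropic coordinates for the quadratic relation -/

section Coordinates

variable {K : Type u} [Field K]

/-- A binary quadratic form over an algebraically closed field has an isotropic vector, which can
be completed to a basis. -/
theorem exists_isotropic_vector [IsAlgClosed K] (a b c : K) :
    ∃ p q : Fin 2 → K, a * p 0 ^ 2 + b * (p 0 * p 1) + c * p 1 ^ 2 = 0 ∧
      p 0 * q 1 - p 1 * q 0 ≠ 0 := by
  by_cases ha : a = 0
  · exact ⟨![1, 0], ![0, 1], by simp [ha], by simp⟩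
  · obtain ⟨z, hz⟩ := IsAlgClosed.exists_root (C a * X ^ 2 + C b * X + C c)
      (by rw [degree_quadratic ha]; exact two_ne_zero)
    refine ⟨![z, 1], ![1, 0], ?_, by simp⟩
    simpa using hz

/-- Isotropy of p is exactly the vanishing of the x² coefficient after substituting t_k = p_k x +
q_k y. -/
theorem lift_relation {B : Type v} [Ring B] [Algebra K B] (D : Matrix (Fin 2) (Fin 2) K)
    (e₀ : K) (e p q : Fin 2 → K) (x y : B)
    (hD : D 0 0 * p 0 ^ 2 + (D 0 1 + D 1 0) * (p 0 * p 1) + D 1 1 * p 1 ^ 2 = 0) :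
    FreeAlgebra.lift K (fun k => p k • x + q k • y)
      (∑ j, (∑ k, D j k • FreeAlgebra.ι K k) * FreeAlgebra.ι K j +
        (e₀ • 1 + ∑ k, e k • FreeAlgebra.ι K k)) =
      (∑ j, ∑ k, D j k * (p k * q j)) • (x * y) + (∑ j, ∑ k, D j k * (q k * p j)) • (y * x) +
        (∑ j, ∑ k, D j k * (q k * q j)) • (y * y) + (∑ k, e k * p k) • x +
        (∑ k, e k * q k) • y + e₀ • 1 := by
  simp only [Fin.sum_univ_two, map_add, map_mul, map_smul, FreeAlgebra.lift_ι_apply, map_one,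
    add_mul, mul_add, smul_mul_assoc, mul_smul_comm, smul_add, smul_smul, add_smul]
  have h : (D 0 0 * p 0 ^ 2 + (D 0 1 + D 1 0) * (p 0 * p 1) + D 1 1 * p 1 ^ 2) • (x * x) = 0 := by
    rw [hD, zero_smul]
  rw [← sub_eq_zero, ← h]
  module

theorem mem_wordSpanLE_one {m : ℕ} {S : Type v} [Ring S] [Algebra K S] {t : Fin m → S} {a : S}
    (ha : a ∈ wordSpanLE K t 1) :
    ∃ (e₀ : K) (e : Fin m → K), a = e₀ • 1 + ∑ k, e k • t k := by
  rw [wordSpanLE, pow_one] at ha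
  obtain ⟨e₀, z, hz, rfl⟩ := Submodule.mem_span_insert.1 ha
  obtain ⟨e, rfl⟩ := (Submodule.mem_span_range_iff_exists_fun K).1 hz
  exact ⟨e₀, e, rfl⟩

/-- The nonhomogeneous quadratic algebras on two generators with nondegenerate quadratic part are
`σ`-filtered skew PBW extensions of a polynomial algebra. -/
theorem exists_isSigmaFiltered_of_quadratic [IsAlgClosed K] {ρ : Fin 1 → FreeAlgebra K (Fin 2)}
    {D : Matrix (Fin 2) (Fin 2) K} (hD : IsUnit D) {e₀ : K} {e : Fin 2 → K}
    (hρ : ρ 0 = ∑ j, (∑ k, D j k • FreeAlgebra.ι K k) * FreeAlgebra.ι K j +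
        (e₀ • 1 + ∑ k, e k • FreeAlgebra.ι K k)) :
    ∃ (R : Subalgebra K (Presented ρ)) (F : PosFiltration K R) (n : ℕ)
      (x : Fin n → Presented ρ),
      1 ≤ n ∧ IsSigmaFiltered R F x ∧ (IsTrivialBase R F ∨ IsPolynomialBase R F) := by
  obtain ⟨p, q, hiso, hbasis⟩ := exists_isotropic_vector (D 0 0) (D 0 1 + D 1 0) (D 1 1)
  have hlift : ∀ {B : Type u} [Ring B] [Algebra K B] (x y : B), _ := fun x y =>
    lift_relation D e₀ e p q x y hiso
  set α : K := ∑ j, ∑ k, D j k * (p k * q j) with hα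
  set β : K := ∑ j, ∑ k, D j k * (q k * p j) with hβ
  set γ : K := ∑ j, ∑ k, D j k * (q k * q j) with hγ
  set a : K := ∑ k, e k * p k
  set b : K := ∑ k, e k * q k
  have hdet : α * β ≠ 0 := by
    -- In the basis p, q the form has entries 0, α, β, γ, hence determinant -αβ, and a change of
    -- basis multiplies the determinant by Δ².
    have h1 : α * β = -(D.det * (p 0 * q 1 - p 1 * q 0) ^ 2) := by
      rw [Matrix.det_fin_two, hα, hβ]
      simp only [Fin.sum_univ_two] at hγ ⊢
      linear_combination γ * hiso - (D 0 0 * p 0 ^ 2 + (D 0 1 + D 1 0) * (p 0 * p 1) +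
        D 1 1 * p 1 ^ 2) * hγ
    rw [h1]
    exact neg_ne_zero.2 (mul_ne_zero ((Matrix.isUnit_iff_isUnit_det D).1 hD).ne_zero
      (pow_ne_zero 2 hbasis))
  have hα0 : α ≠ 0 := left_ne_zero_of_mul hdet
  have hβ0 : β ≠ 0 := right_ne_zero_of_mul hdet
  set Δ := p 0 * q 1 - p 1 * q 0 with hΔ
  let t := gen ρ
  -- Cramer's rule, solving t_k = p_k x + q_k y.
  let x : Presented ρ := Δ⁻¹ • (q 1 • t 0 - q 0 • t 1)
  let y : Presented ρ := Δ⁻¹ • (p 0 • t 1 - p 1 • t 0)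
  have ht : ∀ k, t k = p k • x + q k • y := fun k => by
    have h1 : Δ⁻¹ * (p 0 * q 1 - p 1 * q 0) = 1 := inv_mul_cancel₀ hbasis
    fin_cases k
    · change t 0 = p 0 • Δ⁻¹ • (q 1 • t 0 - q 0 • t 1) + q 0 • Δ⁻¹ • (p 0 • t 1 - p 1 • t 0)
      conv_lhs => rw [← one_smul K (t 0), ← h1]
      module
    · change t 1 = p 1 • Δ⁻¹ • (q 1 • t 0 - q 0 • t 1) + q 1 • Δ⁻¹ • (p 0 • t 1 - p 1 • t 0)
      conv_lhs => rw [← one_smul K (t 1), ← h1]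
      module
  -- The relation solved for xy, which needs α ≠ 0; the condition β ≠ 0 makes the substitution y ↦ f
  -- injective.
  let f : K[X] := C (-(β / α)) * X + C (-(a / α))
  let g : K[X] := C (-(γ / α)) * X ^ 2 + C (-(b / α)) * X + C (-(e₀ / α))
  have hrel : α • (x * y) + β • (y * x) + γ • (y * y) + a • x + b • y + e₀ • 1 = 0 := by
    rw [← hlift x y, ← hρ]
    have : FreeAlgebra.lift K (fun k => p k • x + q k • y) = presentedMk ρ := by
      ext k
      simp only [Function.comp, FreeAlgebra.lift_ι_apply, presentedMk_ι]
      exact (ht k).symm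
    rw [this, presentedMk_relation]
  have hxy : x * y = aeval y f * x + aeval y g := by
    simp only [f, g, map_add, map_mul, aeval_C, aeval_X,
      add_mul, smul_mul_assoc, Algebra.algebraMap_eq_smul_one, one_mul, pow_two]
    have h1 : x * y - α⁻¹ • (α • (x * y) + β • (y * x) + γ • (y * y) + a • x + b • y + e₀ • 1) =
        x * y := by rw [hrel, smul_zero, sub_zero]
    rw [← h1, smul_add, smul_add, smul_add, smul_add, smul_add, inv_smul_smul₀ hα0]
    simp only [div_eq_mul_inv]
    module
  have hgen : Algebra.adjoin K {x, y} = ⊤ := by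
    rw [← top_le_iff, ← adjoin_gen ρ, Algebra.adjoin_le_iff]
    rintro _ ⟨k, rfl⟩
    change t k ∈ _
    rw [ht]
    exact add_mem (Subalgebra.smul_mem _ (Algebra.subset_adjoin (by simp)) _)
      (Subalgebra.smul_mem _ (Algebra.subset_adjoin (by simp)) _)
  let x' := oreOperator f g
  let y' : Module.End K (ℕ → K[X]) := Algebra.lsmul K K (ℕ → K[X]) (X : K[X])
  have hC : ∀ z : K, C α * C (-(z / α)) = -C z := fun z => by
    rw [← C_mul, ← C_neg, mul_neg, mul_div_cancel₀ _ hα0]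
  -- The operators on the Ore extension satisfy the defining relation, so the presented algebra acts
  -- on it.
  have hrel' : α • (x' * y') + β • (y' * x') + γ • (y' * y') + a • x' + b • y' + e₀ • 1 = 0 := by
    refine LinearMap.ext fun v => funext fun n => ?_
    have h1 : (x' * y') v n = f * x' v n + g * v n := by
      change oreOperator f g ((X : K[X]) • v) n = _
      rw [oreOperator_mul, aeval_X, skewDerivation_X]
      rfl
    have h2 : (y' * x') v n = X * x' v n := rfl
    have h3 : (y' * y') v n = X * (X * v n) := rfl
    have h4 : y' v n = X * v n := rfl
    simp only [LinearMap.add_apply, LinearMap.smul_apply, Pi.add_apply, Pi.smul_apply, h1, h2, h3,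
      h4, Module.End.one_apply, LinearMap.zero_apply, Pi.zero_apply, smul_eq_C_mul, f, g]
    linear_combination (X * x' v n) * hC β + x' v n * hC a + (X ^ 2 * v n) * hC γ +
      (X * v n) * hC b + v n * hC e₀
  let Θ : Presented ρ →ₐ[K] Module.End K (ℕ → K[X]) :=
    presentedLift ρ (FreeAlgebra.lift K fun k => p k • x' + q k • y') fun i => by
      rw [Subsingleton.elim i 0, hρ, hlift, hrel']
  have hΘ : ∀ k, Θ (t k) = p k • x' + q k • y' := fun k => by
    simp [Θ, t]
  have h1 : Δ⁻¹ * (p 0 * q 1 - p 1 * q 0) = 1 := inv_mul_cancel₀ hbasis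
  refine exists_isSigmaFiltered_of_ore (neg_ne_zero.2 (div_ne_zero hβ0 hα0)) (f := f) rfl
    (g := g) natDegree_quadratic_le hxy hgen Θ ?_ ?_
  · change Θ (Δ⁻¹ • (q 1 • t 0 - q 0 • t 1)) = x'
    rw [map_smul, map_sub, map_smul, map_smul, hΘ, hΘ]
    conv_rhs => rw [← one_smul K x', ← h1]
    module
  · change Θ (Δ⁻¹ • (p 0 • t 1 - p 1 • t 0)) = y'
    rw [map_smul, map_sub, map_smul, map_smul, hΘ, hΘ]
    conv_rhs => rw [← one_smul K y', ← h1]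
    module

end Coordinates

end SkewPBW

theorem mainTheorem8 {K : Type u} [Field K] [IsAlgClosed K] {m s : ℕ}
    (r : Fin s → FreeAlgebra K (Fin m)) (d : Fin s → ℕ)
    (hr : SkewPBW.IsHomogeneousPresentation r d)
    (hreg : SkewPBW.IsASRegular r 2)
    (l : Fin s → FreeAlgebra K (Fin m))
    (hl : SkewPBW.IsPBWDeformation r d l) :
    ∃ (R : Subalgebra K (SkewPBW.Presented (r + l))) (F : SkewPBW.PosFiltration K R)
      (n : ℕ) (x : Fin n → SkewPBW.Presented (r + l)),
      1 ≤ n ∧ SkewPBW.IsSigmaFiltered R F x ∧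
        (SkewPBW.IsTrivialBase R F ∨ SkewPBW.IsPolynomialBase R F) := by
  obtain rfl := hreg.card_relations_eq_one hr
  obtain rfl := hreg.card_generators_eq_two hr
  obtain ⟨hd, C, hC, hrC⟩ := hreg.exists_nondegenerate_matrix hr
  -- As d = 2, the bound d - 1 leaves only a constant and a linear term in the deformation.
  have h := hl.deg_lt 0
  rw [hd] at h
  obtain ⟨e₀, e, he⟩ := SkewPBW.mem_wordSpanLE_one h
  exact SkewPBW.exists_isSigmaFiltered_of_quadratic hC
    (by rw [Pi.add_apply, hrC, he])
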